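/- **Theorem 3.1 (Composition formula).** Let $\mathbb T^n=\mathbb R^n/\mathbb Z^n$ with its normalised Haar measure, and let $|k|$ be the Euclidean length of $k\in\mathbb Z^n$. For a multi-index $\alpha\in\mathbb N_0^n$ let $|\alpha|=\alpha_1+\dots+\alpha_n$, $\alpha!=\alpha_1!\cdots\alpha_n!$. Let $\Delta^\alpha_k=\Delta_1^{\alpha_1}\cdots\Delta_n^{\alpha_n}$, where $\Delta_j\tau(k)=\tau(k+v_j)-\tau(k)$ and $v_j$ is the $j$-th unit vector, and let $$D_x^{(\alpha)}=D_{x_1}^{(\alpha_1)}\cdots D_{x_n}^{(\alpha_n)},\qquad D_{x_j}^{(\ell)}=\prod_{m=0}^{\ell-1}\Big(\frac1{2\pi i}\frac{\partial}{\partial x_j}-m\Big),\qquad D_{x_j}^{(0)}=I .$$ For $\mu,\rho,\delta\in\mathbb R$, the class $S^\mu_{\rho,\delta}(\mathbb Z^n\times\mathbb T^n)$ consists of the functions $\sigma:\mathbb Z^n\times\mathbb T^n\to\mathbb C$ such that $\sigma(k,\cdot)\in C^\infty(\mathbb T^n)$ for every $k$ and such that for all multi-indices $\alpha,\beta$ there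 is a constant $C_{\alpha,\beta}>0$ with $$|D_x^{(\beta)}\Delta_k^\alpha\sigma(k,x)|\le C_{\alpha,\beta}(1+|k|)^{\mu-\rho|\alpha|+\delta|\beta|}\qquad(k\in\mathbb Z^n,\ x\in\mathbb T^n).$$ Let $\mathcal S(\mathbb Z^n)$ be the space of $f:\mathbb Z^n\to\mathbb C$ such that for every $M$ there is $C$ with $|f(k)|\le C(1+|k|)^{-M}$ for all $k$. For $f\in\mathcal S(\mathbb Z^n)$ put $\widehat f(x)=\sum_{k\in\mathbb Z^n}e^{-2\pi i k\cdot x}f(k)$ and $$\mathrm{Op}(\sigma)f(k)=\int_{\mathbb T^n}e^{2\pi i k\cdot x}\sigma(k,x)\widehat f(x)\,dx,\qquad k\in\mathbb Z^n .$$ Let $0\le\delta<\rho\le1$, $\mu_1,\mu_2\in\mathbb R$, $\sigma\in S^{\mu_1}_{\rho,\delta}(\mathbb Z^n\times\mathbb T^n)$ and $\tau\in S^{\mu_2}_{\rho,\delta}(\mathbb Z^n\times\mathbb T^n)$. Then the composition $\mathrm{Op}(\sigma)\circ\mathrm{Op}(\tau)$ is well defined on $\mathcal S(\mathbb Z^n)$,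 maps $\mathcal S(\mathbb Z^n)$ to itself (as does $\mathrm{Op}(\tau)$), and is a pseudo-difference operator: there is $\varsigma\in S^{\mu_1+\mu_2}_{\rho,\delta}(\mathbb Z^n\times\mathbb T^n)$ such that $\mathrm{Op}(\sigma)(\mathrm{Op}(\tau)f)=\mathrm{Op}(\varsigma)f$ for all $f\in\mathcal S(\mathbb Z^n)$. Moreover $$\varsigma(k,x)\sim\sum_\alpha\frac1{\alpha!}\,D_x^{(\alpha)}\sigma(k,x)\,\Delta_k^\alpha\tau(k,x),$$ which means that for every $N\in\mathbb N_0$ $$\varsigma(k,x)-\sum_{|\alpha|<N}\frac1{\alpha!}\,D_x^{(\alpha)}\sigma(k,x)\,\Delta_k^\alpha\tau(k,x)\in S^{\mu_1+\mu_2-N(\rho-\delta)}_{\rho,\delta}(\mathbb Z^n\times\mathbb T^n).$$ -/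

import Mathlib

open scoped ContDiff

noncomputable section

namespace Lattice

/-- The Euclidean length of a lattice point `k ∈ ℤⁿ`. -/
def latticeNorm {n : ℕ} (k : Fin n → ℤ) : ℝ := Real.sqrt (∑ j, (k j : ℝ) ^ 2)

/-- The order `|α| = α₁ + ⋯ + αₙ` of a multi-index. -/
def order {n : ℕ} (α : Fin n → ℕ) : ℕ := ∑ j, α j

/-- The factorial `α! = α₁! ⋯ αₙ!` of a multi-index. -/
def multiFactorial {n : ℕ} (α : Fin n → ℕ) : ℕ := ∏ j, (α j).factorial

/-- The finite set of multi-indices of order `< N`. -/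
def multiIndicesLT (n N : ℕ) : Finset (Fin n → ℕ) :=
  (Fintype.piFinset fun _ => Finset.range N).filter fun α => order α < N

/-- The first difference operator `Δⱼ τ(k) = τ(k + vⱼ) - τ(k)`, `vⱼ` the `j`-th unit vector. -/
def diff {n : ℕ} (j : Fin n) (τ : (Fin n → ℤ) → ℂ) : (Fin n → ℤ) → ℂ :=
  fun k => τ (k + Pi.single j 1) - τ k

/-- The difference operator `Δ^α = Δ₁^α₁ ⋯ Δₙ^αₙ`. -/
def multiDiff {n : ℕ} (α : Fin n → ℕ) (τ : (Fin n → ℤ) → ℂ) : (Fin n → ℤ) → ℂ :=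
  (List.finRange n).foldr (fun j g => (diff j)^[α j] g) τ

/-- `g ∈ C^∞(𝕋ⁿ)`: the `ℤⁿ`-periodic lift of `g` to `ℝⁿ` is smooth. Here `𝕋ⁿ = ℝⁿ/ℤⁿ`. -/
def SmoothOnTorus {n : ℕ} (g : UnitAddTorus (Fin n) → ℂ) : Prop :=
  ContDiff ℝ ∞ fun y : Fin n → ℝ => g fun j => (y j : UnitAddCircle)

/-- `D_{x_j} = (1 / 2πi) ∂/∂x_j` on functions on the torus. -/
def torusD {n : ℕ} (j : Fin n) (g : UnitAddTorus (Fin n) → ℂ) : UnitAddTorus (Fin n) → ℂ :=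
  fun x => (1 / (2 * (Real.pi : ℂ) * Complex.I)) *
    deriv (fun t : ℝ => g (x + Pi.single j (t : UnitAddCircle))) 0

/-- `D_{x_j}^{(ℓ)} = ∏_{m=0}^{ℓ-1} (D_{x_j} - m)`; in particular `D_{x_j}^{(0)} = I`. -/
def torusDFall {n : ℕ} (j : Fin n) :
    ℕ → (UnitAddTorus (Fin n) → ℂ) → UnitAddTorus (Fin n) → ℂ
  | 0, g => g
  | ℓ + 1, g => fun x => torusD j (torusDFall j ℓ g) x - (ℓ : ℂ) * torusDFall j ℓ g x

/-- `D_x^{(α)} = D_{x_1}^{(α₁)} ⋯ D_{x_n}^{(αₙ)}`. -/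
def multiTorusD {n : ℕ} (α : Fin n → ℕ) (g : UnitAddTorus (Fin n) → ℂ) :
    UnitAddTorus (Fin n) → ℂ :=
  (List.finRange n).foldr (fun j h => torusDFall j (α j) h) g

/-- The symbol class `S^μ_{ρ,δ}(ℤⁿ × 𝕋ⁿ)`. -/
def IsSymbol {n : ℕ} (μ ρ δ : ℝ) (σ : (Fin n → ℤ) → UnitAddTorus (Fin n) → ℂ) : Prop :=
  (∀ k, SmoothOnTorus (σ k)) ∧
  ∀ α β : Fin n → ℕ, ∃ C : ℝ, 0 < C ∧ ∀ (k : Fin n → ℤ) (x : UnitAddTorus (Fin n)),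
    ‖multiTorusD β (fun y => multiDiff α (fun m => σ m y) k) x‖ ≤
      C * (1 + latticeNorm k) ^ (μ - ρ * (order α : ℝ) + δ * (order β : ℝ))

/-- The Schwartz space `𝒮(ℤⁿ)` of rapidly decreasing functions. -/
def IsSchwartz {n : ℕ} (f : (Fin n → ℤ) → ℂ) : Prop :=
  ∀ M : ℝ, ∃ C : ℝ, ∀ k, ‖f k‖ ≤ C * (1 + latticeNorm k) ^ (-M)

/-- The Fourier transform `f̂(x) = ∑_{k ∈ ℤⁿ} e^{-2πi k·x} f(k)`. -/
def latticeFourier {n : ℕ} (f : (Fin n → ℤ) → ℂ) (x : UnitAddTorus (Fin n)) : ℂ :=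
  ∑' k : Fin n → ℤ, UnitAddTorus.mFourier (-k) x * f k

/-- The normalised Haar measure on the torus. -/
def torusMeasure (n : ℕ) : MeasureTheory.Measure (UnitAddTorus (Fin n)) :=
  MeasureTheory.Measure.pi fun _ => AddCircle.haarAddCircle

/-- The lattice quantization `Op(σ)f(k) = ∫_{𝕋ⁿ} e^{2πi k·x} σ(k,x) f̂(x) dx`. -/
def Op {n : ℕ} (σ : (Fin n → ℤ) → UnitAddTorus (Fin n) → ℂ) (f : (Fin n → ℤ) → ℂ) :
    (Fin n → ℤ) → ℂ :=
  fun k => ∫ x, UnitAddTorus.mFourier k x * σ k x * latticeFourier f x ∂(torusMeasure n)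

/-- The term `(1/α!) D_x^{(α)} σ(k,x) Δ_k^α τ(k,x)` of the composition expansion. -/
def compTerm {n : ℕ} (σ τ : (Fin n → ℤ) → UnitAddTorus (Fin n) → ℂ) (α : Fin n → ℕ)
    (k : Fin n → ℤ) (x : UnitAddTorus (Fin n)) : ℂ :=
  (1 / (multiFactorial α : ℂ)) * multiTorusD α (σ k) x * multiDiff α (fun m => τ m x) k

end Lattice

end

/-!
The symbol of the composition is explicit. Writing `σ̂(k, η)` for the Fourier coefficients of
`σ(k, ·)`, the quantization `Op σ` has matrix entries `σ̂(k, m - k)` (`hasSum_Op`), so that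
`Op σ (Op τ f) = Op ς f` for
`ς(k, x) = ∑_η σ̂(k, η) e^{2πi η·x} τ(k + η, x)`
by an exchange of sum and integral (`Op_comp`). The series converges because smoothness of
`σ(k, ·)` makes `σ̂(k, ·)` rapidly decreasing, a factor `(1 + |η|)^{-M}` costing a factor
`(1 + |k|)^{δM}` (`exists_mFourierCoeff_bound`).

Expanding `τ(k + η, x)` by the discrete Taylor formula in `η` gives the asymptotic series, since
multiplication of `σ̂(k, η)` by the falling factorial `η^{(α)}` is the operator `D_x^{(α)}`
(`mFourierCoeff_multiTorusD`, `hasSum_compRem`). The Taylor remainder of order `N` is bounded by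
`|η|^N` times the differences of order `N` of `τ` on the box spanned by `η`
(`norm_taylorRem_le`). For `|η|` small compared with `|k|` these are of size
`(1 + |k|)^{μ₂ - ρN}`; for the other `η` the factor `(1 + |η|)^{-M}` is worth
`(1 + |k|)^{-(1 - δ)M}` in total, which is arbitrarily small as `δ < 1`. This bounds the remainder
with a fixed loss `2nδ` in the order (`hasOrder_compRem`).

No derivative of the remainder is estimated directly. Both `ς` and the terms of the expansion
are bilinear in `(σ, τ)` and satisfy the Leibniz rules
`D_j r[σ, τ] = r[D_j σ, τ] + r[σ, D_j τ]` and
`Δ_j r[σ, τ] = r[Δ_j σ, τ] + r[σ, Δ_j τ] + r[Δ_j σ, Δ_j τ]`,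
hence so does the remainder `r`, and the size estimate for all pairs of symbols yields the
symbol estimates by induction on the number of operators (`symbolUpTo_compRem_aux`). For this the
symbol class is described by iterated single operators in place of the multi-index operators
(`SymbolUpTo`, `isSymbol_iff`). The loss `2nδ` is removed at the end by expanding to a
higher order (`symbolUpTo_compRem`), which is possible as `δ < ρ`.
-/

noncomputable section

namespace Lattice

variable {n : ℕ}

/-! ### Calculus of smooth functions on the torus -/

/-- The `ℤⁿ`-periodic lift to `ℝⁿ` of a function on the torus. -/
def lift (g : UnitAddTorus (Fin n) → ℂ) : (Fin n → ℝ) → ℂ :=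
  fun y => g fun j => (y j : UnitAddCircle)

lemma exists_lift_point (x : UnitAddTorus (Fin n)) :
    ∃ y : Fin n → ℝ, (fun j => (y j : UnitAddCircle)) = x := by
  choose y hy using fun j => QuotientAddGroup.mk_surjective (x j)
  exact ⟨y, funext hy⟩

lemma lift_injective {f g : UnitAddTorus (Fin n) → ℂ} (h : lift f = lift g) : f = g := by
  funext x
  obtain ⟨y, rfl⟩ := exists_lift_point x
  exact congrFun h y

lemma coe_add_single (y : Fin n → ℝ) (j : Fin n) (t : ℝ) :
    (fun i => (y i : UnitAddCircle)) + Pi.single j (t : UnitAddCircle) =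
      fun i => (((y + Pi.single j t : Fin n → ℝ) i : ℝ) : UnitAddCircle) := by
  funext i
  by_cases h : i = j
  · subst h; simp
  · simp [h]

lemma SmoothOnTorus.contDiff {g : UnitAddTorus (Fin n) → ℂ} (hg : SmoothOnTorus g) :
    ContDiff ℝ ∞ (lift g) := hg

lemma SmoothOnTorus.differentiable {g : UnitAddTorus (Fin n) → ℂ} (hg : SmoothOnTorus g) :
    Differentiable ℝ (lift g) := hg.contDiff.differentiable (by simp)

lemma isQuotientMap_coe :
    Topology.IsQuotientMap fun (y : Fin n → ℝ) (j : Fin n) => (y j : UnitAddCircle) :=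
  (IsOpenQuotientMap.piMap fun _ : Fin n =>
    (QuotientAddGroup.isOpenQuotientMap_mk (N := AddSubgroup.zmultiples (1 : ℝ)))).isQuotientMap

lemma SmoothOnTorus.continuous {g : UnitAddTorus (Fin n) → ℂ} (hg : SmoothOnTorus g) :
    Continuous g :=
  isQuotientMap_coe.continuous_iff.2 hg.contDiff.continuous

lemma SmoothOnTorus.exists_bound {g : UnitAddTorus (Fin n) → ℂ} (hg : SmoothOnTorus g) :
    ∃ C, ∀ x, ‖g x‖ ≤ C := by
  obtain ⟨C, hC⟩ := isCompact_univ.exists_bound_of_continuousOn hg.continuous.continuousOn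
  exact ⟨C, fun x => hC x trivial⟩

lemma SmoothOnTorus.hasDerivAt_lift {g : UnitAddTorus (Fin n) → ℂ} (hg : SmoothOnTorus g)
    (j : Fin n) (y : Fin n → ℝ) (t : ℝ) :
    HasDerivAt (fun s : ℝ => lift g (y + Pi.single j s))
      (fderiv ℝ (lift g) (y + Pi.single j t) (Pi.single j 1)) t := by
  have h1 : HasDerivAt (fun s : ℝ => y + Pi.single j s) (Pi.single j (1 : ℝ)) t :=
    (hasDerivAt_single j t).const_add y
  exact (hg.differentiable _).hasFDerivAt.comp_hasDerivAt t h1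

lemma lift_torusD {g : UnitAddTorus (Fin n) → ℂ} (hg : SmoothOnTorus g) (j : Fin n)
    (y : Fin n → ℝ) :
    lift (torusD j g) y =
      (1 / (2 * (Real.pi : ℂ) * Complex.I)) * fderiv ℝ (lift g) y (Pi.single j 1) := by
  have h := (hg.hasDerivAt_lift j y 0).deriv
  rw [Pi.single_zero, add_zero] at h
  simp only [lift, torusD, coe_add_single] at h ⊢
  rw [h]

lemma SmoothOnTorus.hasDerivAt {g : UnitAddTorus (Fin n) → ℂ} (hg : SmoothOnTorus g)
    (j : Fin n) (x : UnitAddTorus (Fin n)) (t : ℝ) :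
    HasDerivAt (fun s : ℝ => g (x + Pi.single j (s : UnitAddCircle)))
      (2 * (Real.pi : ℂ) * Complex.I * torusD j g (x + Pi.single j (t : UnitAddCircle))) t := by
  obtain ⟨y, rfl⟩ := exists_lift_point x
  have h := hg.hasDerivAt_lift j y t
  have h2 := lift_torusD hg j (y + Pi.single j t)
  have h3 : fderiv ℝ (lift g) (y + Pi.single j t) (Pi.single j 1) =
      2 * (Real.pi : ℂ) * Complex.I * lift (torusD j g) (y + Pi.single j t) := by
    rw [h2]; field_simp [Complex.two_pi_I_ne_zero]
  rw [h3] at h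
  simpa only [lift, coe_add_single] using h

lemma torusD_eq_of_hasDerivAt {g : UnitAddTorus (Fin n) → ℂ} {j : Fin n}
    {x : UnitAddTorus (Fin n)} {c : ℂ}
    (h : HasDerivAt (fun s : ℝ => g (x + Pi.single j (s : UnitAddCircle)))
      (2 * (Real.pi : ℂ) * Complex.I * c) 0) : torusD j g x = c := by
  rw [torusD, h.deriv]
  field_simp [Complex.two_pi_I_ne_zero]

lemma SmoothOnTorus.hasDerivAt_zero {g : UnitAddTorus (Fin n) → ℂ} (hg : SmoothOnTorus g)
    (j : Fin n) (x : UnitAddTorus (Fin n)) :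
    HasDerivAt (fun s : ℝ => g (x + Pi.single j (s : UnitAddCircle)))
      (2 * (Real.pi : ℂ) * Complex.I * torusD j g x) 0 := by
  simpa using hg.hasDerivAt j x 0

lemma SmoothOnTorus.torusD {g : UnitAddTorus (Fin n) → ℂ} (hg : SmoothOnTorus g) (j : Fin n) :
    SmoothOnTorus (torusD j g) := by
  have h : lift (Lattice.torusD j g) = fun y =>
      (1 / (2 * (Real.pi : ℂ) * Complex.I)) * fderiv ℝ (lift g) y (Pi.single j 1) :=
    funext (lift_torusD hg j)
  change ContDiff ℝ ∞ (lift (Lattice.torusD j g))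
  rw [h]
  exact contDiff_const.mul
    ((hg.contDiff.fderiv_right (m := ∞) (by simp)).clm_apply contDiff_const)

lemma SmoothOnTorus.add {f g : UnitAddTorus (Fin n) → ℂ} (hf : SmoothOnTorus f)
    (hg : SmoothOnTorus g) : SmoothOnTorus (fun x => f x + g x) :=
  ContDiff.add hf hg

lemma SmoothOnTorus.sub {f g : UnitAddTorus (Fin n) → ℂ} (hf : SmoothOnTorus f)
    (hg : SmoothOnTorus g) : SmoothOnTorus (fun x => f x - g x) :=
  ContDiff.sub hf hg

lemma SmoothOnTorus.mul {f g : UnitAddTorus (Fin n) → ℂ} (hf : SmoothOnTorus f)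
    (hg : SmoothOnTorus g) : SmoothOnTorus (fun x => f x * g x) :=
  ContDiff.mul hf hg

lemma smoothOnTorus_const (c : ℂ) : SmoothOnTorus fun _ : UnitAddTorus (Fin n) => c :=
  contDiff_const

lemma SmoothOnTorus.const_mul {g : UnitAddTorus (Fin n) → ℂ} (hg : SmoothOnTorus g) (c : ℂ) :
    SmoothOnTorus (fun x => c * g x) :=
  (smoothOnTorus_const c).mul hg

lemma torusD_add {f g : UnitAddTorus (Fin n) → ℂ} (hf : SmoothOnTorus f)
    (hg : SmoothOnTorus g) (j : Fin n) :
    torusD j (fun x => f x + g x) = fun x => torusD j f x + torusD j g x := by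
  funext x
  apply torusD_eq_of_hasDerivAt
  rw [mul_add]
  exact (hf.hasDerivAt_zero j x).add (hg.hasDerivAt_zero j x)

lemma torusD_sub {f g : UnitAddTorus (Fin n) → ℂ} (hf : SmoothOnTorus f)
    (hg : SmoothOnTorus g) (j : Fin n) :
    torusD j (fun x => f x - g x) = fun x => torusD j f x - torusD j g x := by
  funext x
  apply torusD_eq_of_hasDerivAt
  rw [mul_sub]
  exact (hf.hasDerivAt_zero j x).sub (hg.hasDerivAt_zero j x)

lemma torusD_mul {f g : UnitAddTorus (Fin n) → ℂ} (hf : SmoothOnTorus f)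
    (hg : SmoothOnTorus g) (j : Fin n) :
    torusD j (fun x => f x * g x) = fun x => torusD j f x * g x + f x * torusD j g x := by
  funext x
  apply torusD_eq_of_hasDerivAt
  have h := (hf.hasDerivAt_zero j x).mul (hg.hasDerivAt_zero j x)
  simp only [QuotientAddGroup.mk_zero, Pi.single_zero, add_zero] at h
  convert! h using 1
  ring

lemma torusD_const_mul {g : UnitAddTorus (Fin n) → ℂ} (hg : SmoothOnTorus g) (c : ℂ)
    (j : Fin n) : torusD j (fun x => c * g x) = fun x => c * torusD j g x := by
  funext x
  apply torusD_eq_of_hasDerivAt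
  rw [mul_left_comm]
  exact (hg.hasDerivAt_zero j x).const_mul c

/-- Equality of mixed second derivatives. -/
lemma torusD_comm {g : UnitAddTorus (Fin n) → ℂ} (hg : SmoothOnTorus g) (i j : Fin n) :
    torusD i (torusD j g) = torusD j (torusD i g) := by
  have key : ∀ i j : Fin n, ∀ y, lift (torusD i (torusD j g)) y =
      (1 / (2 * (Real.pi : ℂ) * Complex.I)) * ((1 / (2 * (Real.pi : ℂ) * Complex.I)) *
        fderiv ℝ (fderiv ℝ (lift g)) y (Pi.single i 1) (Pi.single j 1)) := by
    intro i j y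
    have h : lift (torusD j g) = fun y =>
        (1 / (2 * (Real.pi : ℂ) * Complex.I)) * fderiv ℝ (lift g) y (Pi.single j 1) :=
      funext (lift_torusD hg j)
    have hd : DifferentiableAt ℝ (fderiv ℝ (lift g)) y :=
      ((hg.contDiff.fderiv_right (m := ∞) (by simp)).differentiable (by simp)) y
    have h3 := (hd.hasFDerivAt.clm_apply (hasFDerivAt_const (Pi.single j (1 : ℝ)) y)).const_mul
      (1 / (2 * (Real.pi : ℂ) * Complex.I))
    rw [lift_torusD (hg.torusD j), h, h3.fderiv]
    simp
  apply lift_injective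
  funext y
  rw [key, key]
  have hs : IsSymmSndFDerivAt ℝ (lift g) y :=
    (hg.contDiff.contDiffAt).isSymmSndFDerivAt (by
      rw [minSmoothness_of_isRCLikeNormedField]
      exact WithTop.coe_le_coe.2 (le_top : (2 : ℕ∞) ≤ ⊤))
  rw [hs.eq]

lemma mFourier_add_right (η : Fin n → ℤ) (x y : UnitAddTorus (Fin n)) :
    UnitAddTorus.mFourier η (x + y) = UnitAddTorus.mFourier η x * UnitAddTorus.mFourier η y := by
  simp only [UnitAddTorus.mFourier, ContinuousMap.coe_mk, Pi.add_apply, fourier_apply, smul_add,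
    AddCircle.toCircle_add, Circle.coe_mul, Finset.prod_mul_distrib]

lemma norm_mFourier_apply (η : Fin n → ℤ) (x : UnitAddTorus (Fin n)) :
    ‖UnitAddTorus.mFourier η x‖ = 1 := by
  simp only [UnitAddTorus.mFourier, fourier_apply, ContinuousMap.coe_mk, norm_prod,
    Circle.norm_coe, Finset.prod_const_one]

lemma smoothOnTorus_mFourier (η : Fin n → ℤ) : SmoothOnTorus (UnitAddTorus.mFourier η) := by
  simp only [SmoothOnTorus, UnitAddTorus.mFourier, ContinuousMap.coe_mk, fourier_coe_apply]
  refine contDiff_prod fun i _ => ?_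
  refine ContDiff.cexp ?_
  refine ContDiff.div_const (contDiff_const.mul ?_) _
  exact Complex.ofRealCLM.contDiff.comp (contDiff_apply ℝ ℝ i)

lemma mFourier_single_coe (η : Fin n → ℤ) (j : Fin n) (t : ℝ) :
    UnitAddTorus.mFourier η (Pi.single j (t : UnitAddCircle)) =
      Complex.exp (2 * Real.pi * Complex.I * η j * t) := by
  simp only [UnitAddTorus.mFourier, ContinuousMap.coe_mk]
  rw [Finset.prod_eq_single j]
  · rw [Pi.single_eq_same, fourier_coe_apply]; simp
  · intro i _ hi
    rw [Pi.single_eq_of_ne hi, fourier_eval_zero]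
  · simp

lemma torusD_mFourier (η : Fin n → ℤ) (j : Fin n) :
    torusD j (UnitAddTorus.mFourier η) = fun x => (η j : ℂ) * UnitAddTorus.mFourier η x := by
  funext x
  apply torusD_eq_of_hasDerivAt
  simp only [mFourier_add_right, mFourier_single_coe]
  have h : HasDerivAt (fun t : ℝ => Complex.exp (2 * Real.pi * Complex.I * η j * t))
      (Complex.exp (2 * Real.pi * Complex.I * η j * (0 : ℝ)) *
        (2 * Real.pi * Complex.I * η j * 1)) 0 :=
    ((Complex.ofRealCLM.hasDerivAt (x := (0 : ℝ))).const_mul _).cexp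
  convert! h.const_mul (UnitAddTorus.mFourier η x) using 1
  simp
  ring

/-- The derivatives of order `m + 1` are controlled by those of order `m` of the partial
derivatives. -/
lemma norm_iteratedFDeriv_lift_succ_le {g : UnitAddTorus (Fin n) → ℂ} (hg : SmoothOnTorus g)
    (m : ℕ) (y : Fin n → ℝ) :
    ‖iteratedFDeriv ℝ (m + 1) (lift g) y‖ ≤
      2 * Real.pi * ∑ j, ‖iteratedFDeriv ℝ m (lift (torusD j g)) y‖ := by
  let T : Fin n → ℂ →L[ℝ] (Fin n → ℝ) →L[ℝ] ℂ := fun j =>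
    (ContinuousLinearMap.smulRightL ℝ (Fin n → ℝ) ℂ (ContinuousLinearMap.proj j)).comp
      (ContinuousLinearMap.mul ℝ ℂ (2 * (Real.pi : ℂ) * Complex.I))
  have hT : ∀ j, ‖T j‖ ≤ 2 * Real.pi := by
    intro j
    refine ContinuousLinearMap.opNorm_le_bound _ (by positivity) fun c => ?_
    refine ContinuousLinearMap.opNorm_le_bound _ (by positivity) fun v => ?_
    have hv : ‖v j‖ ≤ ‖v‖ := norm_le_pi_norm v j
    have : (T j c) v = (v j : ℂ) * (2 * (Real.pi : ℂ) * Complex.I * c) := by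
      simp [T]
    rw [this]
    simp only [norm_mul, Complex.norm_real, Complex.norm_I, Complex.norm_ofNat,
      Real.norm_of_nonneg Real.pi_pos.le, mul_one]
    rw [mul_comm]
    gcongr
  have hf : fderiv ℝ (lift g) = fun y => ∑ j : Fin n, (T j ∘ lift (torusD j g)) y := by
    funext y
    refine ContinuousLinearMap.ext fun v => ?_
    have hv : v = ∑ j, v j • (Pi.single j (1 : ℝ) : Fin n → ℝ) := by
      funext i
      simp [Finset.sum_apply, Pi.single_apply]
    conv_lhs => rw [hv]
    rw [map_sum, sum_apply]
    refine Finset.sum_congr rfl fun j _ => ?_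
    rw [map_smul, Function.comp_apply, lift_torusD hg j]
    simp only [T, ContinuousLinearMap.comp_apply, ContinuousLinearMap.mul_apply',
      ContinuousLinearMap.smulRightL_apply_apply, ContinuousLinearMap.smulRight_apply,
      ContinuousLinearMap.proj_apply]
    congr 1
    field_simp [Complex.two_pi_I_ne_zero]
  have hc : ∀ j, ContDiff ℝ ∞ (T j ∘ lift (torusD j g)) := fun j =>
    (T j).contDiff.comp (hg.torusD j).contDiff
  rw [← norm_iteratedFDeriv_fderiv, hf,
    iteratedFDeriv_fun_sum_apply (fun j _ => ((hc j).of_le (by exact_mod_cast le_top)).contDiffAt),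
    Finset.mul_sum]
  refine (norm_sum_le _ _).trans (Finset.sum_le_sum fun j _ => ?_)
  refine ((T j).norm_iteratedFDeriv_comp_left (hg.torusD j).contDiff.contDiffAt
    (by exact_mod_cast le_top)).trans ?_
  gcongr
  exact hT j

/-! ### The weight `1 + |k|` on the lattice -/

/-- The weight `1 + |k|`. -/
def bracket (k : Fin n → ℤ) : ℝ := 1 + latticeNorm k

lemma latticeNorm_eq_norm (k : Fin n → ℤ) :
    latticeNorm k = ‖WithLp.toLp 2 fun j => (k j : ℝ)‖ := by
  simp [latticeNorm, EuclideanSpace.norm_eq]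

lemma latticeNorm_nonneg (k : Fin n → ℤ) : 0 ≤ latticeNorm k := Real.sqrt_nonneg _

lemma latticeNorm_add_le (k l : Fin n → ℤ) :
    latticeNorm (k + l) ≤ latticeNorm k + latticeNorm l := by
  simp only [latticeNorm_eq_norm]
  refine le_trans (le_of_eq ?_) (norm_add_le _ _)
  congr 1
  ext j
  simp

lemma latticeNorm_neg (k : Fin n → ℤ) : latticeNorm (-k) = latticeNorm k := by
  simp [latticeNorm]

lemma latticeNorm_mono {k l : Fin n → ℤ} (h : ∀ j, |k j| ≤ |l j|) :
    latticeNorm k ≤ latticeNorm l := by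
  refine Real.sqrt_le_sqrt (Finset.sum_le_sum fun j _ => ?_)
  rw [sq_le_sq]
  exact_mod_cast h j

lemma abs_apply_le_latticeNorm (k : Fin n → ℤ) (j : Fin n) : |(k j : ℝ)| ≤ latticeNorm k := by
  rw [latticeNorm_eq_norm]
  exact PiLp.norm_apply_le (WithLp.toLp 2 fun j => (k j : ℝ)) j

lemma latticeNorm_le_sum_abs (k : Fin n → ℤ) : latticeNorm k ≤ ∑ j, |(k j : ℝ)| := by
  refine Real.sqrt_le_iff.2 ⟨by positivity, ?_⟩
  simp only [← sq_abs (k _ : ℝ)]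
  exact Finset.sum_sq_le_sq_sum_of_nonneg fun j _ => abs_nonneg _

lemma one_le_bracket (k : Fin n → ℤ) : 1 ≤ bracket k := by
  have := latticeNorm_nonneg k
  simp only [bracket]; linarith

lemma bracket_pos (k : Fin n → ℤ) : 0 < bracket k := one_pos.trans_le (one_le_bracket k)

lemma bracket_rpow_pos (k : Fin n → ℤ) (s : ℝ) : 0 < bracket k ^ s :=
  Real.rpow_pos_of_pos (bracket_pos k) s

lemma bracket_neg (k : Fin n → ℤ) : bracket (-k) = bracket k := by
  rw [bracket, latticeNorm_neg, bracket]

lemma abs_apply_le_bracket (k : Fin n → ℤ) (j : Fin n) : |(k j : ℝ)| ≤ bracket k :=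
  (abs_apply_le_latticeNorm k j).trans (by simp [bracket])

lemma bracket_add_le (k l : Fin n → ℤ) : bracket (k + l) ≤ bracket k * bracket l := by
  have h := latticeNorm_add_le k l
  have := latticeNorm_nonneg k
  have := latticeNorm_nonneg l
  simp only [bracket]
  nlinarith

lemma bracket_rpow_mono (k : Fin n → ℤ) {s t : ℝ} (h : s ≤ t) : bracket k ^ s ≤ bracket k ^ t :=
  Real.rpow_le_rpow_of_exponent_le (one_le_bracket k) h

lemma bracket_rpow_add (k : Fin n → ℤ) (s t : ℝ) :
    bracket k ^ (s + t) = bracket k ^ s * bracket k ^ t :=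
  Real.rpow_add (bracket_pos k) s t

/-- Peetre's inequality. -/
lemma bracket_add_rpow_le (k l : Fin n → ℤ) (s : ℝ) :
    bracket (k + l) ^ s ≤ bracket k ^ s * bracket l ^ |s| := by
  rcases le_total 0 s with hs | hs
  · rw [abs_of_nonneg hs, ← Real.mul_rpow (bracket_pos k).le (bracket_pos l).le]
    exact Real.rpow_le_rpow (bracket_pos _).le (bracket_add_le k l) hs
  · have h : bracket k ≤ bracket (k + l) * bracket l := by
      have := bracket_add_le (k + l) (-l)
      rwa [add_neg_cancel_right, bracket_neg] at this
    have h2 := Real.rpow_le_rpow_of_nonpos (bracket_pos k) h hs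
    rw [Real.mul_rpow (bracket_pos _).le (bracket_pos _).le] at h2
    rw [abs_of_nonpos hs]
    calc bracket (k + l) ^ s
        = bracket (k + l) ^ s * bracket l ^ s * bracket l ^ (-s) := by
          rw [mul_assoc, ← bracket_rpow_add]; simp
      _ ≤ bracket k ^ s * bracket l ^ (-s) := by
          gcongr
          exact (bracket_rpow_pos _ _).le

lemma summable_int_one_add_abs : Summable fun m : ℤ => ((1 + |(m : ℝ)|) ^ 2)⁻¹ := by
  refine Summable.of_nonneg_of_le (fun m => by positivity) (fun m => ?_)
    ((Real.summable_one_div_int_add_rpow (1 / 2) 2).2 one_lt_two)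
  have h0 : (0 : ℝ) < |(m : ℝ) + 1 / 2| := by
    rw [abs_pos]
    intro h
    have h2 : ((2 * m + 1 : ℤ) : ℝ) = 0 := by push_cast; linarith
    have h3 : 2 * m + 1 = 0 := by exact_mod_cast h2
    omega
  have h1 : |(m : ℝ) + 1 / 2| ≤ 1 + |(m : ℝ)| := by
    refine (abs_add_le _ _).trans ?_
    rw [abs_of_pos (by norm_num : (0 : ℝ) < 1 / 2)]
    linarith
  rw [one_div, Real.rpow_two]
  gcongr

/-- Comparison with the product of the one-dimensional weights `(1 + |k_j|)²`. -/
lemma summable_bracket : Summable fun k : Fin n → ℤ => (bracket k ^ (2 * n))⁻¹ := by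
  have key : Summable fun k : Fin n → ℤ => ∏ j, ((1 + |(k j : ℝ)|) ^ 2)⁻¹ := by
    refine summable_of_sum_le (c := (∑' m : ℤ, ((1 + |(m : ℝ)|) ^ 2)⁻¹) ^ n)
      (fun k => by positivity) fun s => ?_
    obtain ⟨t, ht⟩ : ∃ t : Fin n → Finset ℤ, ∀ k ∈ s, ∀ j, k j ∈ t j :=
      ⟨fun j => s.image fun k => k j, fun k hk j => Finset.mem_image_of_mem (fun k => k j) hk⟩
    calc ∑ k ∈ s, ∏ j, ((1 + |(k j : ℝ)|) ^ 2)⁻¹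
        ≤ ∑ k ∈ Fintype.piFinset t, ∏ j, ((1 + |(k j : ℝ)|) ^ 2)⁻¹ := by
          refine Finset.sum_le_sum_of_subset_of_nonneg (fun k hk => ?_)
            fun k _ _ => by positivity
          exact Fintype.mem_piFinset.2 fun j => ht k hk j
      _ = ∏ j : Fin n, ∑ m ∈ t j, ((1 + |(m : ℝ)|) ^ 2)⁻¹ :=
          (Finset.prod_univ_sum t fun _ m => ((1 + |(m : ℝ)|) ^ 2)⁻¹).symm
      _ ≤ ∏ _j : Fin n, ∑' m : ℤ, ((1 + |(m : ℝ)|) ^ 2)⁻¹ :=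
          Finset.prod_le_prod (fun j _ => by positivity) fun j _ =>
            summable_int_one_add_abs.sum_le_tsum _ fun m _ => by positivity
      _ = _ := by simp
  refine Summable.of_nonneg_of_le (fun k => by have := bracket_pos k; positivity)
    (fun k => ?_) key
  rw [Finset.prod_inv_distrib, Finset.prod_pow, mul_comm, pow_mul]
  have h : ∏ j, (1 + |(k j : ℝ)|) ≤ bracket k ^ n := by
    have h2 : ∏ j, (1 + |(k j : ℝ)|) ≤ ∏ _j : Fin n, bracket k :=
      Finset.prod_le_prod (fun j _ => by positivity) fun j _ =>
        add_le_add_right (abs_apply_le_latticeNorm k j) 1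
    simpa using h2
  gcongr

/-! ### Symbols and their elementary operators -/

/-- The derivative `D_{x_j}` acting on functions of `(k, x)`. -/
def symD (j : Fin n) (σ : (Fin n → ℤ) → UnitAddTorus (Fin n) → ℂ) :
    (Fin n → ℤ) → UnitAddTorus (Fin n) → ℂ :=
  fun k => torusD j (σ k)

/-- The difference `Δ_j` acting on functions of `(k, x)`. -/
def symDiff (j : Fin n) (σ : (Fin n → ℤ) → UnitAddTorus (Fin n) → ℂ) :
    (Fin n → ℤ) → UnitAddTorus (Fin n) → ℂ :=
  fun k x => σ (k + Pi.single j 1) x - σ k x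

/-- Smooth functions of size `O((1 + |k|)^μ)`. -/
def HasOrder (μ : ℝ) (σ : (Fin n → ℤ) → UnitAddTorus (Fin n) → ℂ) : Prop :=
  (∀ k, SmoothOnTorus (σ k)) ∧ ∃ C, 0 ≤ C ∧ ∀ k x, ‖σ k x‖ ≤ C * bracket k ^ μ

/-- The symbol estimates of order `μ` for all compositions of at most `L` of the operators
`D_{x_j}` and `Δ_j`, in any order. Requiring this for every `L` describes the symbol class
(`isSymbol_iff`), and proofs about the class become inductions on `L` that use the
Leibniz rules for a single operator only. -/
def SymbolUpTo (ρ δ : ℝ) : ℕ → ℝ → ((Fin n → ℤ) → UnitAddTorus (Fin n) → ℂ) → Prop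
  | 0, μ, σ => HasOrder μ σ
  | L + 1, μ, σ => HasOrder μ σ ∧
      ∀ j, SymbolUpTo ρ δ L (μ + δ) (symD j σ) ∧ SymbolUpTo ρ δ L (μ - ρ) (symDiff j σ)

lemma HasOrder.mono {μ ν : ℝ} {σ : (Fin n → ℤ) → UnitAddTorus (Fin n) → ℂ}
    (h : HasOrder μ σ) (hμ : μ ≤ ν) : HasOrder ν σ := by
  obtain ⟨hs, C, hC, hb⟩ := h
  exact ⟨hs, C, hC, fun k x => (hb k x).trans (by gcongr; exact one_le_bracket k)⟩

lemma HasOrder.add {μ : ℝ} {σ τ : (Fin n → ℤ) → UnitAddTorus (Fin n) → ℂ}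
    (hσ : HasOrder μ σ) (hτ : HasOrder μ τ) : HasOrder μ (σ + τ) := by
  obtain ⟨hs, C, hC, hb⟩ := hσ
  obtain ⟨ht, C', hC', hb'⟩ := hτ
  refine ⟨fun k => (hs k).add (ht k), C + C', by positivity, fun k x => ?_⟩
  rw [add_mul]
  exact (norm_add_le _ _).trans (add_le_add (hb k x) (hb' k x))

lemma HasOrder.const_smul {μ : ℝ} {σ : (Fin n → ℤ) → UnitAddTorus (Fin n) → ℂ}
    (hσ : HasOrder μ σ) (c : ℂ) : HasOrder μ (c • σ) := by
  obtain ⟨hs, C, hC, hb⟩ := hσ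
  refine ⟨fun k => (hs k).const_mul c, ‖c‖ * C, by positivity, fun k x => ?_⟩
  rw [Pi.smul_apply, Pi.smul_apply, norm_smul, mul_assoc]
  exact mul_le_mul_of_nonneg_left (hb k x) (norm_nonneg _)

lemma HasOrder.mul {μ ν : ℝ} {σ τ : (Fin n → ℤ) → UnitAddTorus (Fin n) → ℂ}
    (hσ : HasOrder μ σ) (hτ : HasOrder ν τ) : HasOrder (μ + ν) (σ * τ) := by
  obtain ⟨hs, C, hC, hb⟩ := hσ
  obtain ⟨ht, C', hC', hb'⟩ := hτ
  refine ⟨fun k => (hs k).mul (ht k), C * C', by positivity, fun k x => ?_⟩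
  rw [bracket_rpow_add, mul_mul_mul_comm, Pi.mul_apply, Pi.mul_apply, norm_mul]
  exact mul_le_mul (hb k x) (hb' k x) (norm_nonneg _) ((norm_nonneg _).trans (hb k x))

section Operators

variable {σ τ : (Fin n → ℤ) → UnitAddTorus (Fin n) → ℂ}

lemma symD_add (hσ : ∀ k, SmoothOnTorus (σ k)) (hτ : ∀ k, SmoothOnTorus (τ k)) (j : Fin n) :
    symD j (σ + τ) = symD j σ + symD j τ :=
  funext fun k => torusD_add (hσ k) (hτ k) j

lemma symD_const_smul (hσ : ∀ k, SmoothOnTorus (σ k)) (c : ℂ) (j : Fin n) :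
    symD j (c • σ) = c • symD j σ :=
  funext fun k => torusD_const_mul (hσ k) c j

lemma symD_mul (hσ : ∀ k, SmoothOnTorus (σ k)) (hτ : ∀ k, SmoothOnTorus (τ k)) (j : Fin n) :
    symD j (σ * τ) = symD j σ * τ + σ * symD j τ :=
  funext fun k => torusD_mul (hσ k) (hτ k) j

lemma symDiff_add (j : Fin n) : symDiff j (σ + τ) = symDiff j σ + symDiff j τ := by
  funext k x
  simp only [symDiff, Pi.add_apply]; ring

lemma symDiff_const_smul (c : ℂ) (j : Fin n) : symDiff j (c • σ) = c • symDiff j σ := by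
  funext k x
  simp only [symDiff, Pi.smul_apply, smul_eq_mul]; ring

lemma symDiff_mul (j : Fin n) :
    symDiff j (σ * τ) = symDiff j σ * τ + σ * symDiff j τ + symDiff j σ * symDiff j τ := by
  funext k x
  simp only [symDiff, Pi.add_apply, Pi.mul_apply]; ring

end Operators

namespace SymbolUpTo

variable {ρ δ μ ν : ℝ} {L : ℕ} {σ τ : (Fin n → ℤ) → UnitAddTorus (Fin n) → ℂ}

lemma hasOrder (h : SymbolUpTo ρ δ L μ σ) : HasOrder μ σ := by
  cases L with
  | zero => exact h
  | succ L => exact h.1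

lemma smooth (h : SymbolUpTo ρ δ L μ σ) : ∀ k, SmoothOnTorus (σ k) := h.hasOrder.1

lemma mono (h : SymbolUpTo ρ δ L μ σ) (hμ : μ ≤ ν) : SymbolUpTo ρ δ L ν σ := by
  induction L generalizing μ ν σ with
  | zero => exact HasOrder.mono h hμ
  | succ L ih =>
    exact ⟨h.1.mono hμ, fun j => ⟨ih (h.2 j).1 (by linarith), ih (h.2 j).2 (by linarith)⟩⟩

lemma of_succ (h : SymbolUpTo ρ δ (L + 1) μ σ) : SymbolUpTo ρ δ L μ σ := by
  induction L generalizing μ σ with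
  | zero => exact h.1
  | succ L ih => exact ⟨h.1, fun j => ⟨ih (h.2 j).1, ih (h.2 j).2⟩⟩

lemma add (hσ : SymbolUpTo ρ δ L μ σ) (hτ : SymbolUpTo ρ δ L μ τ) :
    SymbolUpTo ρ δ L μ (σ + τ) := by
  induction L generalizing μ σ τ with
  | zero => exact HasOrder.add hσ hτ
  | succ L ih =>
    refine ⟨hσ.1.add hτ.1, fun j => ⟨?_, ?_⟩⟩
    · rw [symD_add hσ.smooth hτ.smooth]
      exact ih (hσ.2 j).1 (hτ.2 j).1
    · rw [symDiff_add]
      exact ih (hσ.2 j).2 (hτ.2 j).2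

lemma const_smul (hσ : SymbolUpTo ρ δ L μ σ) (c : ℂ) : SymbolUpTo ρ δ L μ (c • σ) := by
  induction L generalizing μ σ with
  | zero => exact HasOrder.const_smul hσ c
  | succ L ih =>
    refine ⟨hσ.1.const_smul c, fun j => ⟨?_, ?_⟩⟩
    · rw [symD_const_smul hσ.smooth]
      exact ih (hσ.2 j).1
    · rw [symDiff_const_smul]
      exact ih (hσ.2 j).2

lemma zero : SymbolUpTo ρ δ L μ (0 : (Fin n → ℤ) → UnitAddTorus (Fin n) → ℂ) := by
  have h0 : ∀ ν : ℝ, HasOrder ν (0 : (Fin n → ℤ) → UnitAddTorus (Fin n) → ℂ) := fun ν =>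
    ⟨fun _ => smoothOnTorus_const 0, 0, le_rfl, fun k x => by simp⟩
  induction L generalizing μ with
  | zero => exact h0 μ
  | succ L ih =>
    refine ⟨h0 μ, fun j => ⟨?_, ?_⟩⟩
    · have := symD_const_smul (h0 0).1 0 j
      rw [zero_smul, zero_smul] at this
      rw [this]
      exact ih
    · have := symDiff_const_smul (σ := (0 : (Fin n → ℤ) → UnitAddTorus (Fin n) → ℂ)) 0 j
      rw [zero_smul, zero_smul] at this
      rw [this]
      exact ih

lemma sum {ι : Type*} {s : Finset ι} {f : ι → (Fin n → ℤ) → UnitAddTorus (Fin n) → ℂ}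
    (h : ∀ i ∈ s, SymbolUpTo ρ δ L μ (f i)) : SymbolUpTo ρ δ L μ (∑ i ∈ s, f i) :=
  Finset.sum_induction f _ (fun _ _ => add) zero h

lemma mul (hρ : 0 ≤ ρ) (hσ : SymbolUpTo ρ δ L μ σ) (hτ : SymbolUpTo ρ δ L ν τ) :
    SymbolUpTo ρ δ L (μ + ν) (σ * τ) := by
  induction L generalizing μ ν σ τ with
  | zero => exact HasOrder.mul hσ hτ
  | succ L ih =>
    refine ⟨hσ.1.mul hτ.1, fun j => ⟨?_, ?_⟩⟩
    · rw [symD_mul hσ.smooth hτ.smooth]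
      exact ((ih (hσ.2 j).1 hτ.of_succ).mono (by linarith)).add
        ((ih hσ.of_succ (hτ.2 j).1).mono (by linarith))
    · rw [symDiff_mul]
      exact (((ih (hσ.2 j).2 hτ.of_succ).mono (by linarith)).add
        ((ih hσ.of_succ (hτ.2 j).2).mono (by linarith))).add
        ((ih (hσ.2 j).2 (hτ.2 j).2).mono (by linarith))

end SymbolUpTo

/-! ### Multi-index operators and the description of the symbol class by iterated operators -/

section TorusDFall

variable {f g : UnitAddTorus (Fin n) → ℂ}

lemma SmoothOnTorus.torusDFall (hg : SmoothOnTorus g) (j : Fin n) (m : ℕ) :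
    SmoothOnTorus (torusDFall j m g) := by
  induction m with
  | zero => exact hg
  | succ m ih => exact (ih.torusD j).sub (ih.const_mul _)

lemma torusDFall_add (hf : SmoothOnTorus f) (hg : SmoothOnTorus g) (j : Fin n) (m : ℕ) :
    torusDFall j m (fun x => f x + g x) = fun x => torusDFall j m f x + torusDFall j m g x := by
  induction m with
  | zero => rfl
  | succ m ih =>
    funext x
    simp only [torusDFall, ih, torusD_add (hf.torusDFall j m) (hg.torusDFall j m)]
    ring

lemma torusDFall_const_mul (hg : SmoothOnTorus g) (c : ℂ) (j : Fin n) (m : ℕ) :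
    torusDFall j m (fun x => c * g x) = fun x => c * torusDFall j m g x := by
  induction m with
  | zero => rfl
  | succ m ih =>
    funext x
    simp only [torusDFall, ih, torusD_const_mul (hg.torusDFall j m)]
    ring

lemma torusD_torusDFall_comm (hg : SmoothOnTorus g) (i j : Fin n) (m : ℕ) :
    torusD i (torusDFall j m g) = torusDFall j m (torusD i g) := by
  induction m with
  | zero => rfl
  | succ m ih =>
    have h := hg.torusDFall j m
    have h2 : torusDFall j (m + 1) g =
        fun x => torusD j (torusDFall j m g) x - (m : ℂ) * torusDFall j m g x := rfl
    rw [h2, torusD_sub (h.torusD j) (h.const_mul _), torusD_comm h, torusD_const_mul h, ih]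
    rfl

/-- The operator `∏_{j ∈ l} D_{x_j}^{(β_j)}` over a list of coordinates. -/
def listTorusD (β : Fin n → ℕ) (l : List (Fin n)) (g : UnitAddTorus (Fin n) → ℂ) :
    UnitAddTorus (Fin n) → ℂ :=
  l.foldr (fun j h => torusDFall j (β j) h) g

lemma multiTorusD_eq (β : Fin n → ℕ) (g : UnitAddTorus (Fin n) → ℂ) :
    multiTorusD β g = listTorusD β (List.finRange n) g := rfl

lemma SmoothOnTorus.listTorusD (hg : SmoothOnTorus g) (β : Fin n → ℕ) (l : List (Fin n)) :
    SmoothOnTorus (listTorusD β l g) := by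
  induction l with
  | nil => exact hg
  | cons i l ih => exact ih.torusDFall i (β i)

lemma listTorusD_add (hf : SmoothOnTorus f) (hg : SmoothOnTorus g) (β : Fin n → ℕ)
    (l : List (Fin n)) : listTorusD β l (fun x => f x + g x) =
      fun x => listTorusD β l f x + listTorusD β l g x := by
  induction l with
  | nil => rfl
  | cons i l ih =>
    change torusDFall i (β i) (listTorusD β l _) = _
    rw [ih, torusDFall_add (hf.listTorusD β l) (hg.listTorusD β l)]
    rfl

lemma listTorusD_const_mul (hg : SmoothOnTorus g) (c : ℂ) (β : Fin n → ℕ) (l : List (Fin n)) :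
    listTorusD β l (fun x => c * g x) = fun x => c * listTorusD β l g x := by
  induction l with
  | nil => rfl
  | cons i l ih =>
    change torusDFall i (β i) (listTorusD β l _) = _
    rw [ih, torusDFall_const_mul (hg.listTorusD β l)]
    rfl

lemma torusD_listTorusD_comm (hg : SmoothOnTorus g) (i : Fin n) (β : Fin n → ℕ)
    (l : List (Fin n)) : torusD i (listTorusD β l g) = listTorusD β l (torusD i g) := by
  induction l with
  | nil => rfl
  | cons j l ih =>
    change torusD i (torusDFall j (β j) (listTorusD β l g)) = _
    rw [torusD_torusDFall_comm (hg.listTorusD β l), ih]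
    rfl

lemma listTorusD_congr {β γ : Fin n → ℕ} {l : List (Fin n)} (h : ∀ i ∈ l, β i = γ i)
    (g : UnitAddTorus (Fin n) → ℂ) : listTorusD β l g = listTorusD γ l g := by
  induction l with
  | nil => rfl
  | cons j l ih =>
    change torusDFall j (β j) (listTorusD β l g) = torusDFall j (γ j) (listTorusD γ l g)
    rw [ih fun i hi => h i (List.mem_cons_of_mem _ hi), h j List.mem_cons_self]

lemma torusD_listTorusD_of_mem (hg : SmoothOnTorus g) {j : Fin n} (β : Fin n → ℕ)
    {l : List (Fin n)} (hl : l.Nodup) (hj : j ∈ l) :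
    torusD j (listTorusD β l g) = fun x =>
      listTorusD (β + Pi.single j 1) l g x + (β j : ℂ) * listTorusD β l g x := by
  induction l with
  | nil => simp at hj
  | cons i l ih =>
    rw [List.nodup_cons] at hl
    have hs := hg.listTorusD β l
    by_cases hij : i = j
    · subst hij
      have hc : listTorusD (β + Pi.single i 1) l g = listTorusD β l g := by
        refine listTorusD_congr (fun m hm => ?_) g
        have : m ≠ i := fun h => hl.1 (h ▸ hm)
        simp [this]
      change _ = fun x => torusDFall i ((β + Pi.single i 1 : Fin n → ℕ) i)
        (listTorusD (β + Pi.single i 1) l g) x +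
          (β i : ℂ) * torusDFall i (β i) (listTorusD β l g) x
      rw [hc]
      funext x
      simp [torusDFall, listTorusD]
    · have hjl : j ∈ l := (List.mem_cons.1 hj).resolve_left fun h => hij h.symm
      change torusD j (torusDFall i (β i) (listTorusD β l g)) = _
      rw [torusD_torusDFall_comm hs, ih hl.2 hjl,
        torusDFall_add (hg.listTorusD _ l) (hs.const_mul _), torusDFall_const_mul hs]
      have : (β + Pi.single j 1 : Fin n → ℕ) i = β i := by simp [hij]
      change _ = fun x => torusDFall i ((β + Pi.single j 1 : Fin n → ℕ) i)
        (listTorusD (β + Pi.single j 1) l g) x + _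
      rw [this]
      rfl

lemma SmoothOnTorus.multiTorusD (hg : SmoothOnTorus g) (β : Fin n → ℕ) :
    SmoothOnTorus (multiTorusD β g) := hg.listTorusD β _

lemma multiTorusD_add (hf : SmoothOnTorus f) (hg : SmoothOnTorus g) (β : Fin n → ℕ) :
    multiTorusD β (fun x => f x + g x) = fun x => multiTorusD β f x + multiTorusD β g x :=
  listTorusD_add hf hg β _

lemma multiTorusD_const_mul (hg : SmoothOnTorus g) (c : ℂ) (β : Fin n → ℕ) :
    multiTorusD β (fun x => c * g x) = fun x => c * multiTorusD β g x :=
  listTorusD_const_mul hg c β _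

lemma multiTorusD_sub (hf : SmoothOnTorus f) (hg : SmoothOnTorus g) (β : Fin n → ℕ) :
    multiTorusD β (fun x => f x - g x) = fun x => multiTorusD β f x - multiTorusD β g x := by
  have h := multiTorusD_add hf (hg.const_mul (-1)) β
  rw [multiTorusD_const_mul hg] at h
  simpa only [neg_one_mul, ← sub_eq_add_neg] using h

lemma torusD_multiTorusD_comm (hg : SmoothOnTorus g) (i : Fin n) (β : Fin n → ℕ) :
    torusD i (multiTorusD β g) = multiTorusD β (torusD i g) :=
  torusD_listTorusD_comm hg i β _

/-- Raising a falling power: `D^{(β + e_j)} = (D_j - β_j) D^{(β)}`. -/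
lemma torusD_multiTorusD (hg : SmoothOnTorus g) (j : Fin n) (β : Fin n → ℕ) :
    torusD j (multiTorusD β g) = fun x =>
      multiTorusD (β + Pi.single j 1) g x + (β j : ℂ) * multiTorusD β g x :=
  torusD_listTorusD_of_mem hg β (List.nodup_finRange n) (List.mem_finRange j)

end TorusDFall

section MultiDiff

/-- The operator `∏_{j ∈ l} Δ_j^{α_j}` over a list of coordinates. -/
def listDiff (α : Fin n → ℕ) (l : List (Fin n)) (t : (Fin n → ℤ) → ℂ) : (Fin n → ℤ) → ℂ :=
  l.foldr (fun j g => (diff j)^[α j] g) t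

lemma multiDiff_eq (α : Fin n → ℕ) (t : (Fin n → ℤ) → ℂ) :
    multiDiff α t = listDiff α (List.finRange n) t := rfl

lemma diff_commute (i j : Fin n) : Function.Commute (diff i) (diff j) := by
  intro t
  funext k
  simp only [diff, add_right_comm k (Pi.single i 1) (Pi.single j 1)]
  ring

lemma diff_listDiff_comm (i : Fin n) (α : Fin n → ℕ) (l : List (Fin n))
    (t : (Fin n → ℤ) → ℂ) : diff i (listDiff α l t) = listDiff α l (diff i t) := by
  induction l with
  | nil => rfl
  | cons j l ih =>
    change diff i ((diff j)^[α j] (listDiff α l t)) = (diff j)^[α j] (listDiff α l (diff i t))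
    rw [← ih]
    exact (diff_commute i j).iterate_right (α j) _

lemma listDiff_congr {α γ : Fin n → ℕ} {l : List (Fin n)} (h : ∀ i ∈ l, α i = γ i)
    (t : (Fin n → ℤ) → ℂ) : listDiff α l t = listDiff γ l t := by
  induction l with
  | nil => rfl
  | cons j l ih =>
    change (diff j)^[α j] (listDiff α l t) = (diff j)^[γ j] (listDiff γ l t)
    rw [ih fun i hi => h i (List.mem_cons_of_mem _ hi), h j List.mem_cons_self]

lemma diff_listDiff_of_mem {j : Fin n} (α : Fin n → ℕ) {l : List (Fin n)} (hl : l.Nodup)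
    (hj : j ∈ l) (t : (Fin n → ℤ) → ℂ) :
    diff j (listDiff α l t) = listDiff (α + Pi.single j 1) l t := by
  induction l with
  | nil => simp at hj
  | cons i l ih =>
    rw [List.nodup_cons] at hl
    change diff j ((diff i)^[α i] (listDiff α l t)) =
      (diff i)^[(α + Pi.single j 1 : Fin n → ℕ) i] (listDiff (α + Pi.single j 1) l t)
    by_cases hij : i = j
    · subst hij
      have hc : listDiff (α + Pi.single i 1) l t = listDiff α l t := by
        refine listDiff_congr (fun m hm => ?_) t
        have : m ≠ i := fun h => hl.1 (h ▸ hm)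
        simp [this]
      rw [hc, ← Function.iterate_succ_apply' (diff i)]
      simp
    · have hjl : j ∈ l := (List.mem_cons.1 hj).resolve_left fun h => hij h.symm
      rw [(diff_commute j i).iterate_right (α i) _, ih hl.2 hjl]
      simp [hij]

lemma diff_multiDiff (j : Fin n) (α : Fin n → ℕ) (t : (Fin n → ℤ) → ℂ) :
    diff j (multiDiff α t) = multiDiff (α + Pi.single j 1) t :=
  diff_listDiff_of_mem α (List.nodup_finRange n) (List.mem_finRange j) t

lemma multiDiff_diff (j : Fin n) (α : Fin n → ℕ) (t : (Fin n → ℤ) → ℂ) :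
    multiDiff α (diff j t) = multiDiff (α + Pi.single j 1) t := by
  rw [← diff_multiDiff]
  exact (diff_listDiff_comm j α _ t).symm

lemma multiDiff_zero (t : (Fin n → ℤ) → ℂ) : multiDiff 0 t = t := by
  rw [multiDiff_eq]
  induction List.finRange n with
  | nil => rfl
  | cons j l ih => exact ih

lemma multiTorusD_zero (g : UnitAddTorus (Fin n) → ℂ) : multiTorusD 0 g = g := by
  rw [multiTorusD_eq]
  induction List.finRange n with
  | nil => rfl
  | cons j l ih => exact ih

end MultiDiff

/-- The operator `D_x^{(β)}` acting on functions of `(k, x)`. -/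
def multiSymD (β : Fin n → ℕ) (σ : (Fin n → ℤ) → UnitAddTorus (Fin n) → ℂ) :
    (Fin n → ℤ) → UnitAddTorus (Fin n) → ℂ :=
  fun k => multiTorusD β (σ k)

/-- The operator `Δ_k^α` acting on functions of `(k, x)`. -/
def multiSymDiff (α : Fin n → ℕ) (σ : (Fin n → ℤ) → UnitAddTorus (Fin n) → ℂ) :
    (Fin n → ℤ) → UnitAddTorus (Fin n) → ℂ :=
  fun k x => multiDiff α (fun m => σ m x) k

section SymbolClass

variable {ρ δ μ : ℝ} {σ : (Fin n → ℤ) → UnitAddTorus (Fin n) → ℂ}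

lemma symbolUpTo_symD (h : ∀ L, SymbolUpTo ρ δ L μ σ) (j : Fin n) :
    ∀ L, SymbolUpTo ρ δ L (μ + δ) (symD j σ) := fun L => ((h (L + 1)).2 j).1

lemma symbolUpTo_symDiff (h : ∀ L, SymbolUpTo ρ δ L μ σ) (j : Fin n) :
    ∀ L, SymbolUpTo ρ δ L (μ - ρ) (symDiff j σ) := fun L => ((h (L + 1)).2 j).2

lemma symbolUpTo_torusDFall (hδ : 0 ≤ δ) (h : ∀ L, SymbolUpTo ρ δ L μ σ) (j : Fin n) (m : ℕ) :
    ∀ L, SymbolUpTo ρ δ L (μ + δ * m) (fun k => torusDFall j m (σ k)) := by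
  induction m with
  | zero => simpa using! h
  | succ m ih =>
    intro L
    have h1 := (symbolUpTo_symD ih j L).add (((ih L).const_smul (-(m : ℂ))).mono
      (le_add_of_nonneg_right hδ))
    convert! h1 using 1
    · push_cast; ring
    · funext k x
      simp only [torusDFall, symD, Pi.add_apply, Pi.smul_apply, smul_eq_mul]
      ring

lemma symbolUpTo_listTorusD (hδ : 0 ≤ δ) (h : ∀ L, SymbolUpTo ρ δ L μ σ) (β : Fin n → ℕ)
    (l : List (Fin n)) :
    ∀ L, SymbolUpTo ρ δ L (μ + δ * ((l.map β).sum : ℕ)) (fun k => listTorusD β l (σ k)) := by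
  induction l with
  | nil => simpa using! h
  | cons i l ih =>
    intro L
    have h1 := symbolUpTo_torusDFall hδ ih i (β i) L
    convert! h1 using 1
    simp only [List.map_cons, List.sum_cons]
    push_cast; ring

lemma symbolUpTo_multiSymD (hδ : 0 ≤ δ) (h : ∀ L, SymbolUpTo ρ δ L μ σ) (β : Fin n → ℕ) :
    ∀ L, SymbolUpTo ρ δ L (μ + δ * order β) (multiSymD β σ) := by
  have := symbolUpTo_listTorusD hδ h β (List.finRange n)
  rwa [← Fin.sum_univ_def] at this

lemma symbolUpTo_iterate_diff (h : ∀ L, SymbolUpTo ρ δ L μ σ) (j : Fin n) (m : ℕ) :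
    ∀ L, SymbolUpTo ρ δ L (μ - ρ * m) (fun k x => (diff j)^[m] (fun i => σ i x) k) := by
  induction m with
  | zero => simpa using h
  | succ m ih =>
    intro L
    have h1 := symbolUpTo_symDiff ih j L
    convert! h1 using 1
    · push_cast; ring
    · funext k x
      rw [Function.iterate_succ_apply']
      rfl

lemma symbolUpTo_listDiff (h : ∀ L, SymbolUpTo ρ δ L μ σ) (α : Fin n → ℕ)
    (l : List (Fin n)) :
    ∀ L, SymbolUpTo ρ δ L (μ - ρ * ((l.map α).sum : ℕ))
      (fun k x => listDiff α l (fun i => σ i x) k) := by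
  induction l with
  | nil => simpa using! h
  | cons i l ih =>
    intro L
    have h1 := symbolUpTo_iterate_diff ih i (α i) L
    convert! h1 using 1
    simp only [List.map_cons, List.sum_cons]
    push_cast; ring

lemma symbolUpTo_multiSymDiff (h : ∀ L, SymbolUpTo ρ δ L μ σ) (α : Fin n → ℕ) :
    ∀ L, SymbolUpTo ρ δ L (μ - ρ * order α) (multiSymDiff α σ) := by
  have := symbolUpTo_listDiff h α (List.finRange n)
  rwa [← Fin.sum_univ_def] at this

lemma smooth_listDiff (h : ∀ k, SmoothOnTorus (σ k)) (α : Fin n → ℕ) (l : List (Fin n)) :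
    ∀ k, SmoothOnTorus fun x => listDiff α l (fun i => σ i x) k := by
  induction l with
  | nil => exact h
  | cons i l ih =>
    change ∀ k, SmoothOnTorus fun x => (diff i)^[α i] (listDiff α l fun i => σ i x) k
    induction α i with
    | zero => exact ih
    | succ m ihm =>
      simp only [Function.iterate_succ_apply']
      exact fun k => (ihm _).sub (ihm k)

lemma torusD_iterate_diff (h : ∀ k, SmoothOnTorus (σ k)) (i j : Fin n) (m : ℕ) :
    (∀ k, SmoothOnTorus fun x => (diff i)^[m] (fun l => σ l x) k) ∧
    ∀ k, torusD j (fun x => (diff i)^[m] (fun l => σ l x) k) =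
      fun x => (diff i)^[m] (fun l => torusD j (σ l) x) k := by
  induction m with
  | zero => exact ⟨h, fun k => rfl⟩
  | succ m ih =>
    simp only [Function.iterate_succ_apply']
    refine ⟨fun k => (ih.1 _).sub (ih.1 k), fun k => ?_⟩
    have h2 := torusD_sub (ih.1 (k + Pi.single i 1)) (ih.1 k) j
    rw [ih.2, ih.2] at h2
    exact h2

lemma torusD_listDiff (h : ∀ k, SmoothOnTorus (σ k)) (j : Fin n) (α : Fin n → ℕ)
    (l : List (Fin n)) (k : Fin n → ℤ) :
    torusD j (fun x => listDiff α l (fun i => σ i x) k) =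
      fun x => listDiff α l (fun i => torusD j (σ i) x) k := by
  induction l generalizing k with
  | nil => rfl
  | cons i l ih =>
    have h2 := (torusD_iterate_diff (smooth_listDiff h α l) i j (α i)).2 k
    simp only [ih] at h2
    exact h2

lemma smooth_multiSymDiff (h : ∀ k, SmoothOnTorus (σ k)) (α : Fin n → ℕ) :
    ∀ k, SmoothOnTorus (multiSymDiff α σ k) := smooth_listDiff h α _

lemma multiSymDiff_symD (h : ∀ k, SmoothOnTorus (σ k)) (j : Fin n) (α : Fin n → ℕ) :
    multiSymDiff α (symD j σ) = symD j (multiSymDiff α σ) :=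
  funext fun k => (torusD_listDiff h j α _ k).symm

lemma order_add_single (α : Fin n → ℕ) (j : Fin n) :
    order (α + Pi.single j 1) = order α + 1 := by
  simp [order, Finset.sum_add_distrib]

lemma symDiff_multiSymDiff (j : Fin n) (α : Fin n → ℕ) :
    symDiff j (multiSymDiff α σ) = multiSymDiff (α + Pi.single j 1) σ := by
  funext k x
  exact congrFun (diff_multiDiff j α fun m => σ m x) k

lemma multiSymDiff_symDiff (j : Fin n) (α : Fin n → ℕ) :
    multiSymDiff α (symDiff j σ) = symDiff j (multiSymDiff α σ) := by
  rw [symDiff_multiSymDiff]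
  funext k x
  exact congrFun (multiDiff_diff j α fun m => σ m x) k

lemma symD_multiSymD (h : ∀ k, SmoothOnTorus (σ k)) (j : Fin n) (β : Fin n → ℕ) :
    symD j (multiSymD β σ) =
      multiSymD (β + Pi.single j 1) σ + (β j : ℂ) • multiSymD β σ :=
  funext fun k => torusD_multiTorusD (h k) j β

lemma multiSymD_symD (h : ∀ k, SmoothOnTorus (σ k)) (j : Fin n) (β : Fin n → ℕ) :
    multiSymD β (symD j σ) = symD j (multiSymD β σ) :=
  funext fun k => (torusD_multiTorusD_comm (h k) j β).symm

lemma multiSymD_symDiff (h : ∀ k, SmoothOnTorus (σ k)) (j : Fin n) (β : Fin n → ℕ) :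
    multiSymD β (symDiff j σ) = symDiff j (multiSymD β σ) :=
  funext fun k => multiTorusD_sub (h _) (h k) β

/-- Iterated single operators and the multi-index operators define the same symbol class. -/
theorem isSymbol_iff (hδ : 0 ≤ δ) : IsSymbol μ ρ δ σ ↔ ∀ L, SymbolUpTo ρ δ L μ σ := by
  constructor
  · rintro ⟨hs, hb⟩
    have hsm : ∀ α β k, SmoothOnTorus (multiSymD β (multiSymDiff α σ) k) := fun α β k =>
      (smooth_multiSymDiff hs α k).multiTorusD β
    have hord : ∀ α β, HasOrder (μ - ρ * order α + δ * order β)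
        (multiSymD β (multiSymDiff α σ)) := by
      intro α β
      obtain ⟨C, hC, h⟩ := hb α β
      exact ⟨hsm α β, C, hC.le, h⟩
    have key : ∀ L α β, SymbolUpTo ρ δ L (μ - ρ * order α + δ * order β)
        (multiSymD β (multiSymDiff α σ)) := by
      intro L
      induction L with
      | zero => exact hord
      | succ L ih =>
        refine fun α β => ⟨hord α β, fun j => ⟨?_, ?_⟩⟩
        · rw [symD_multiSymD (smooth_multiSymDiff hs α)]
          refine SymbolUpTo.add ((ih α _).mono (le_of_eq ?_))
            (((ih α β).const_smul _).mono (by linarith))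
          rw [order_add_single]
          push_cast; ring
        · rw [← multiSymD_symDiff (smooth_multiSymDiff hs α), symDiff_multiSymDiff]
          refine (ih _ β).mono (le_of_eq ?_)
          rw [order_add_single]
          push_cast; ring
    intro L
    have h0 := key L 0 0
    have h1 : multiSymD 0 (multiSymDiff 0 σ) = σ := by
      funext k
      simp only [multiSymD, multiTorusD_zero]
      funext x
      simp only [multiSymDiff, multiDiff_zero]
    rw [h1] at h0
    simpa [order] using h0
  · intro h
    refine ⟨(h 0).smooth, fun α β => ?_⟩
    obtain ⟨-, C, hC, hb⟩ := (symbolUpTo_multiSymD hδ (symbolUpTo_multiSymDiff h α) β 0).hasOrder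
    refine ⟨C + 1, by positivity, fun k x => (hb k x).trans ?_⟩
    exact mul_le_mul_of_nonneg_right (by linarith) (bracket_rpow_pos k _).le

end SymbolClass

/-! ### The terms of the asymptotic expansion -/

section CompTerm

variable {ρ δ μ ν : ℝ} {σ τ σ' τ' : (Fin n → ℤ) → UnitAddTorus (Fin n) → ℂ}

lemma compTerm_eq (α : Fin n → ℕ) : compTerm σ τ α =
    (1 / (multiFactorial α : ℂ)) • (multiSymD α σ * multiSymDiff α τ) := by
  funext k x
  simp only [compTerm, multiSymD, multiSymDiff, Pi.smul_apply, Pi.mul_apply, smul_eq_mul]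
  ring

lemma symbolUpTo_compTerm (hδ : 0 ≤ δ) (hρ : 0 ≤ ρ) (hσ : ∀ L, SymbolUpTo ρ δ L μ σ)
    (hτ : ∀ L, SymbolUpTo ρ δ L ν τ) (α : Fin n → ℕ) :
    ∀ L, SymbolUpTo ρ δ L (μ + ν - order α * (ρ - δ)) (compTerm σ τ α) := by
  intro L
  rw [compTerm_eq]
  refine SymbolUpTo.const_smul (SymbolUpTo.mono (SymbolUpTo.mul hρ (symbolUpTo_multiSymD hδ hσ α L)
    (symbolUpTo_multiSymDiff hτ α L)) (le_of_eq ?_)) _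
  ring

lemma symD_compTerm (hσ : ∀ k, SmoothOnTorus (σ k)) (hτ : ∀ k, SmoothOnTorus (τ k)) (j : Fin n)
    (α : Fin n → ℕ) : symD j (compTerm σ τ α) =
      compTerm (symD j σ) τ α + compTerm σ (symD j τ) α := by
  have h1 : ∀ k, SmoothOnTorus (multiSymD α σ k) := fun k => (hσ k).multiTorusD α
  have h2 := smooth_multiSymDiff hτ α
  have h3 : ∀ k, SmoothOnTorus ((multiSymD α σ * multiSymDiff α τ) k) :=
    fun k => (h1 k).mul (h2 k)
  rw [compTerm_eq, symD_const_smul h3, symD_mul h1 h2, compTerm_eq,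
    compTerm_eq, multiSymD_symD hσ, multiSymDiff_symD hτ, smul_add]

lemma symDiff_compTerm (hσ : ∀ k, SmoothOnTorus (σ k)) (j : Fin n)
    (α : Fin n → ℕ) : symDiff j (compTerm σ τ α) =
      compTerm (symDiff j σ) τ α + compTerm σ (symDiff j τ) α +
        compTerm (symDiff j σ) (symDiff j τ) α := by
  simp only [compTerm_eq, symDiff_const_smul, symDiff_mul, multiSymD_symDiff hσ,
    multiSymDiff_symDiff, smul_add]

end CompTerm

/-! ### Fourier coefficients of symbols -/

open UnitAddTorus MeasureTheory

instance : IsProbabilityMeasure (torusMeasure n) := by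
  unfold torusMeasure; infer_instance

instance : (torusMeasure n).IsAddHaarMeasure := by
  unfold torusMeasure; infer_instance

/-- Mathlib's Fourier coefficients use the normalised Haar measure, definitionally
`torusMeasure`. -/
lemma mFourierCoeff_eq (g : UnitAddTorus (Fin n) → ℂ) (η : Fin n → ℤ) :
    mFourierCoeff g η = ∫ x, mFourier (-η) x * g x ∂(torusMeasure n) := rfl

lemma integrable_of_continuous {g : UnitAddTorus (Fin n) → ℂ} (hg : Continuous g) :
    Integrable g (torusMeasure n) :=
  hg.integrable_of_hasCompactSupport (HasCompactSupport.of_compactSpace g)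

lemma norm_integral_le {E : Type*} [NormedAddCommGroup E] [NormedSpace ℝ E]
    {g : UnitAddTorus (Fin n) → E} {C : ℝ} (hC : ∀ x, ‖g x‖ ≤ C) :
    ‖∫ x, g x ∂(torusMeasure n)‖ ≤ C := by
  simpa using norm_integral_le_of_norm_le_const (μ := torusMeasure n)
    (Filter.Eventually.of_forall hC)

lemma norm_mFourierCoeff_le {g : UnitAddTorus (Fin n) → ℂ} {C : ℝ} (hC : ∀ x, ‖g x‖ ≤ C)
    (η : Fin n → ℤ) : ‖mFourierCoeff g η‖ ≤ C :=
  norm_integral_le fun x => by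
    rw [smul_eq_mul, norm_mul, norm_mFourier_apply, one_mul]; exact hC x

/-- The integral of a partial derivative vanishes, because the integral of a function over the
torus is invariant under translations. -/
lemma integral_torusD {g : UnitAddTorus (Fin n) → ℂ} (hg : SmoothOnTorus g) (j : Fin n) :
    ∫ x, torusD j g x ∂(torusMeasure n) = 0 := by
  obtain ⟨C, hC⟩ := (hg.torusD j).exists_bound
  have hc : ∀ {f : UnitAddTorus (Fin n) → ℂ}, Continuous f → ∀ a, Continuous fun x => f (x + a) :=
    fun hf a => hf.comp (continuous_add_const a)
  have hbound : ∀ (x : UnitAddTorus (Fin n)) (t : ℝ), ‖2 * (Real.pi : ℂ) * Complex.I *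
      torusD j g (x + Pi.single j (t : UnitAddCircle))‖ ≤ 2 * Real.pi * C := by
    intro x t
    simp only [norm_mul, Complex.norm_real, Complex.norm_I, Complex.norm_ofNat,
      Real.norm_of_nonneg Real.pi_pos.le, mul_one]
    gcongr
    exact hC _
  have hF : ∀ t : ℝ, Continuous fun x : UnitAddTorus (Fin n) => g (x + Pi.single j (t : UnitAddCircle)) :=
    fun t => hc hg.continuous _
  have hF' : Continuous fun x : UnitAddTorus (Fin n) => 2 * (Real.pi : ℂ) * Complex.I *
      torusD j g (x + Pi.single j ((0 : ℝ) : UnitAddCircle)) :=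
    continuous_const.mul (hc (hg.torusD j).continuous _)
  have h : HasDerivAt
      (fun t : ℝ => ∫ x, g (x + Pi.single j (t : UnitAddCircle)) ∂(torusMeasure n))
      (∫ x, 2 * (Real.pi : ℂ) * Complex.I *
        torusD j g (x + Pi.single j ((0 : ℝ) : UnitAddCircle)) ∂(torusMeasure n)) 0 := by
    refine (hasDerivAt_integral_of_dominated_loc_of_deriv_le (μ := torusMeasure n)
      (F := fun (t : ℝ) x => g (x + Pi.single j (t : UnitAddCircle)))
      (F' := fun (t : ℝ) x => 2 * (Real.pi : ℂ) * Complex.I *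
        torusD j g (x + Pi.single j (t : UnitAddCircle))) (s := Set.univ)
      (bound := fun _ => 2 * Real.pi * C) Filter.univ_mem ?_ ?_ ?_ ?_ ?_ ?_).2
    · exact Filter.Eventually.of_forall fun t => (hF t).aestronglyMeasurable
    · exact integrable_of_continuous (hF 0)
    · exact hF'.aestronglyMeasurable
    · exact Filter.Eventually.of_forall fun x t _ => hbound x t
    · exact integrable_const _
    · exact Filter.Eventually.of_forall fun x t _ => hg.hasDerivAt j x t
  have hinv : ∀ t : ℝ, ∫ x, g (x + Pi.single j (t : UnitAddCircle)) ∂(torusMeasure n) =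
      ∫ x, g x ∂(torusMeasure n) := fun t => integral_add_right_eq_self g _
  simp only [hinv] at h
  have h3 := h.unique (hasDerivAt_const _ _)
  rw [integral_const_mul] at h3
  have h4 := (mul_eq_zero.1 h3).resolve_left Complex.two_pi_I_ne_zero
  simpa using h4

lemma mFourierCoeff_torusD {g : UnitAddTorus (Fin n) → ℂ} (hg : SmoothOnTorus g) (j : Fin n)
    (η : Fin n → ℤ) : mFourierCoeff (torusD j g) η = (η j : ℂ) * mFourierCoeff g η := by
  have hm := smoothOnTorus_mFourier (-η)
  have h := integral_torusD (hm.mul hg) j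
  rw [torusD_mul hm hg, torusD_mFourier] at h
  rw [integral_add (integrable_of_continuous
      (((hm.const_mul _).mul hg).continuous))
    (integrable_of_continuous ((hm.mul (hg.torusD j)).continuous))] at h
  simp only [mul_assoc, integral_const_mul] at h
  rw [mFourierCoeff_eq, mFourierCoeff_eq]
  simp only [Pi.neg_apply, Int.cast_neg, neg_mul] at h
  exact (neg_add_eq_zero.1 h).symm

lemma mFourierCoeff_add {f g : UnitAddTorus (Fin n) → ℂ} (hf : SmoothOnTorus f)
    (hg : SmoothOnTorus g) (η : Fin n → ℤ) :
    mFourierCoeff (fun x => f x + g x) η = mFourierCoeff f η + mFourierCoeff g η := by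
  simp only [mFourierCoeff_eq, mul_add]
  have hm := smoothOnTorus_mFourier (-η)
  exact integral_add (integrable_of_continuous (hm.mul hf).continuous)
    (integrable_of_continuous (hm.mul hg).continuous)

lemma mFourierCoeff_const_mul (g : UnitAddTorus (Fin n) → ℂ) (c : ℂ) (η : Fin n → ℤ) :
    mFourierCoeff (fun x => c * g x) η = c * mFourierCoeff g η := by
  simp only [mFourierCoeff_eq, mul_left_comm _ c, integral_const_mul]

lemma mFourierCoeff_sub {f g : UnitAddTorus (Fin n) → ℂ} (hf : SmoothOnTorus f)
    (hg : SmoothOnTorus g) (η : Fin n → ℤ) :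
    mFourierCoeff (fun x => f x - g x) η = mFourierCoeff f η - mFourierCoeff g η := by
  have h := mFourierCoeff_add hf (hg.const_mul (-1)) η
  rw [mFourierCoeff_const_mul] at h
  simpa only [neg_one_mul, ← sub_eq_add_neg] using h

lemma mFourierCoeff_torusDFall {g : UnitAddTorus (Fin n) → ℂ} (hg : SmoothOnTorus g) (j : Fin n)
    (m : ℕ) (η : Fin n → ℤ) : mFourierCoeff (torusDFall j m g) η =
      (descPochhammer ℂ m).eval (η j : ℂ) * mFourierCoeff g η := by
  induction m with
  | zero => simp [torusDFall]
  | succ m ih =>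
    have hs := hg.torusDFall j m
    have h := mFourierCoeff_sub (hs.torusD j) (hs.const_mul m) η
    rw [mFourierCoeff_torusD hs, mFourierCoeff_const_mul, ih] at h
    refine h.trans ?_
    rw [descPochhammer_succ_eval]
    ring

/-- The operator `D^{(α)}` is the Fourier multiplier `η ↦ η^{(α)}`, a product of falling
factorials. -/
lemma mFourierCoeff_multiTorusD {g : UnitAddTorus (Fin n) → ℂ} (hg : SmoothOnTorus g)
    (α : Fin n → ℕ) (η : Fin n → ℤ) : mFourierCoeff (multiTorusD α g) η =
      (∏ j, (descPochhammer ℂ (α j)).eval (η j : ℂ)) * mFourierCoeff g η := by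
  rw [multiTorusD_eq, Fin.prod_univ_def]
  induction List.finRange n with
  | nil => simp [listTorusD]
  | cons i l ih =>
    change mFourierCoeff (torusDFall i (α i) (listTorusD α l g)) η = _
    rw [mFourierCoeff_torusDFall (hg.listTorusD α l), ih, List.map_cons, List.prod_cons, mul_assoc]

lemma hasSum_mFourier {g : UnitAddTorus (Fin n) → ℂ} (hg : SmoothOnTorus g)
    (hs : Summable fun η => ‖mFourierCoeff g η‖) (x : UnitAddTorus (Fin n)) :
    HasSum (fun η => mFourierCoeff g η * mFourier η x) (g x) :=
  hasSum_mFourier_series_apply_of_summable (f := ⟨g, hg.continuous⟩) hs.of_norm x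

section Decay

variable {ρ δ μ ν : ℝ} {σ τ : (Fin n → ℤ) → UnitAddTorus (Fin n) → ℂ}

/-- The Fourier coefficients in `x` of a symbol decay rapidly, each power of `1 + |η|` costing
a power `(1 + |k|)^δ`. -/
lemma exists_mFourierCoeff_bound (hδ : 0 ≤ δ) (M : ℕ) (hσ : SymbolUpTo ρ δ M μ σ) :
    ∃ C, 0 ≤ C ∧ ∀ k η, ‖mFourierCoeff (σ k) η‖ * bracket η ^ M ≤
      C * bracket k ^ (μ + δ * M) := by
  induction M generalizing μ σ with
  | zero =>
    obtain ⟨-, C, hC, h⟩ := hσ.hasOrder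
    refine ⟨C, hC, fun k η => ?_⟩
    simpa using norm_mFourierCoeff_le (h k) η
  | succ M ih =>
    obtain ⟨C, hC, h⟩ := ih hσ.of_succ
    choose B hB hb using fun j => ih (hσ.2 j).1
    refine ⟨C + ∑ j, B j, add_nonneg hC (Finset.sum_nonneg fun j _ => hB j), fun k η => ?_⟩
    have h1 : bracket η ≤ 1 + ∑ j, |(η j : ℝ)| :=
      add_le_add_right (latticeNorm_le_sum_abs η) 1
    have hp : 0 ≤ bracket η ^ M := pow_nonneg (bracket_pos η).le M
    calc ‖mFourierCoeff (σ k) η‖ * bracket η ^ (M + 1)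
        = ‖mFourierCoeff (σ k) η‖ * bracket η ^ M * bracket η := by ring
      _ ≤ ‖mFourierCoeff (σ k) η‖ * bracket η ^ M * (1 + ∑ j, |(η j : ℝ)|) := by
          gcongr
      _ = ‖mFourierCoeff (σ k) η‖ * bracket η ^ M +
            ∑ j, ‖mFourierCoeff (symD j σ k) η‖ * bracket η ^ M := by
          rw [mul_add, mul_one, Finset.mul_sum]
          congr 1
          refine Finset.sum_congr rfl fun j _ => ?_
          rw [symD, mFourierCoeff_torusD (hσ.smooth k), norm_mul, Complex.norm_intCast]
          ring
      _ ≤ C * bracket k ^ (μ + δ * (M + 1 : ℕ)) +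
            ∑ j, B j * bracket k ^ (μ + δ * (M + 1 : ℕ)) := by
          refine add_le_add ((h k η).trans ?_) (Finset.sum_le_sum fun j _ => (hb j k η).trans ?_)
          · refine mul_le_mul_of_nonneg_left (bracket_rpow_mono k ?_) hC
            push_cast; linarith
          · refine mul_le_mul_of_nonneg_left (bracket_rpow_mono k ?_) (hB j)
            push_cast; linarith
      _ = _ := by rw [add_mul, Finset.sum_mul]

lemma summable_mFourierCoeff_mul (hδ : 0 ≤ δ) (hσ : ∀ L, SymbolUpTo ρ δ L μ σ)
    (k : Fin n → ℤ) (Q : ℕ) :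
    Summable fun η => ‖mFourierCoeff (σ k) η‖ * bracket η ^ Q := by
  obtain ⟨C, hC, h⟩ := exists_mFourierCoeff_bound hδ (Q + 2 * n) (hσ _)
  refine Summable.of_nonneg_of_le (fun η => by have := bracket_pos η; positivity) (fun η => ?_)
    (summable_bracket.mul_left (C * bracket k ^ (μ + δ * (Q + 2 * n : ℕ))))
  have hp : 0 < bracket η ^ (2 * n) := pow_pos (bracket_pos η) _
  rw [← div_eq_mul_inv, le_div_iff₀ hp, mul_assoc, ← pow_add]
  exact h k η

lemma summable_mFourierCoeff (hδ : 0 ≤ δ) (hσ : ∀ L, SymbolUpTo ρ δ L μ σ) (k : Fin n → ℤ) :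
    Summable fun η => ‖mFourierCoeff (σ k) η‖ := by
  simpa using summable_mFourierCoeff_mul hδ hσ k 0

lemma HasOrder.exists_translate_bound (hτ : HasOrder ν τ) :
    ∃ C, 0 ≤ C ∧ ∃ Q : ℕ, ∀ k η x, ‖τ (k + η) x‖ ≤ C * bracket k ^ ν * bracket η ^ Q := by
  obtain ⟨-, C, hC, h⟩ := hτ
  refine ⟨C, hC, ⌈|ν|⌉₊, fun k η x => (h _ x).trans ?_⟩
  rw [mul_assoc]
  refine mul_le_mul_of_nonneg_left ((bracket_add_rpow_le k η ν).trans ?_) hC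
  rw [← Real.rpow_natCast]
  gcongr
  · exact (bracket_rpow_pos k ν).le
  · exact one_le_bracket η
  · exact Nat.le_ceil _

end Decay

/-! ### The symbol of the composition -/

/-- The composition symbol `ς(k, x) = ∑_η σ̂(k, η) e^{2πi η·x} τ(k + η, x)`, where `σ̂(k, ·)` are
the Fourier coefficients of `σ(k, ·)`. -/
def compSymbol (σ τ : (Fin n → ℤ) → UnitAddTorus (Fin n) → ℂ) :
    (Fin n → ℤ) → UnitAddTorus (Fin n) → ℂ :=
  fun k x => ∑' η, mFourierCoeff (σ k) η * (mFourier η x * τ (k + η) x)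

section CompSymbol

variable {ρ δ μ ν : ℝ} {σ τ τ' : (Fin n → ℤ) → UnitAddTorus (Fin n) → ℂ}

lemma torusD_mFourier_mul {g : UnitAddTorus (Fin n) → ℂ} (hg : SmoothOnTorus g) (η : Fin n → ℤ)
    (j : Fin n) : torusD j (fun x => mFourier η x * g x) =
      fun x => (η j : ℂ) * (mFourier η x * g x) + mFourier η x * torusD j g x := by
  rw [torusD_mul (smoothOnTorus_mFourier η) hg, torusD_mFourier]
  simp only [mul_assoc]

lemma exists_iteratedFDeriv_bound (hτ : ∀ L, SymbolUpTo ρ δ L ν τ) (k : Fin n → ℤ) (m : ℕ) :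
    ∃ C, 0 ≤ C ∧ ∃ Q : ℕ, ∀ η y,
      ‖iteratedFDeriv ℝ m (lift fun x => mFourier η x * τ (k + η) x) y‖ ≤ C * bracket η ^ Q := by
  induction m generalizing ν τ with
  | zero =>
    obtain ⟨C, hC, Q, h⟩ := (hτ 0).hasOrder.exists_translate_bound
    refine ⟨C * bracket k ^ ν, mul_nonneg hC (bracket_rpow_pos k ν).le, Q, fun η y => ?_⟩
    rw [norm_iteratedFDeriv_zero, lift, norm_mul, norm_mFourier_apply, one_mul]
    exact h k η _
  | succ m ih =>
    obtain ⟨C, hC, Q, h⟩ := ih hτ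
    choose B hB P hb using fun j => ih (symbolUpTo_symD hτ j)
    have hsum : 0 ≤ ∑ j, (C + B j) := Finset.sum_nonneg fun j _ => add_nonneg hC (hB j)
    refine ⟨2 * Real.pi * ∑ j, (C + B j), by positivity, Q + 1 + ∑ j, P j, fun η y => ?_⟩
    have hs : SmoothOnTorus fun x => mFourier η x * τ (k + η) x :=
      (smoothOnTorus_mFourier η).mul ((hτ 0).smooth _)
    refine (norm_iteratedFDeriv_lift_succ_le hs m y).trans ?_
    rw [mul_assoc (2 * Real.pi), Finset.sum_mul]
    gcongr with j _
    have h1 : SmoothOnTorus fun x => mFourier η x * torusD j (τ (k + η)) x :=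
      (smoothOnTorus_mFourier η).mul (((hτ 0).smooth _).torusD j)
    have e : lift (torusD j fun x => mFourier η x * τ (k + η) x) =
        ((η j : ℂ) • lift fun x => mFourier η x * τ (k + η) x) +
          lift fun x => mFourier η x * symD j τ (k + η) x := by
      rw [torusD_mFourier_mul ((hτ 0).smooth _)]
      rfl
    have c1 : ContDiffAt ℝ m (lift fun x => mFourier η x * τ (k + η) x) y :=
      (hs.contDiff.of_le (by exact_mod_cast le_top)).contDiffAt
    have c2 : ContDiffAt ℝ m (lift fun x => mFourier η x * symD j τ (k + η) x) y :=
      (h1.contDiff.of_le (by exact_mod_cast le_top)).contDiffAt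
    have c3 : ContDiffAt ℝ m ((η j : ℂ) • lift fun x => mFourier η x * τ (k + η) x) y :=
      c1.const_smul (η j : ℂ)
    rw [e, iteratedFDeriv_add_apply c3 c2, iteratedFDeriv_const_smul_apply c1]
    refine (norm_add_le _ _).trans ?_
    rw [norm_smul, Complex.norm_intCast, add_mul]
    have hone := one_le_bracket η
    refine add_le_add ?_ ?_
    · calc |(η j : ℝ)| * _ ≤ bracket η * (C * bracket η ^ Q) :=
            mul_le_mul (abs_apply_le_bracket η j) (h η y) (norm_nonneg _) (bracket_pos η).le
        _ = C * bracket η ^ (Q + 1) := by ring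
        _ ≤ _ := mul_le_mul_of_nonneg_left (pow_le_pow_right₀ hone (by omega)) hC
    · refine (hb j η y).trans ?_
      have hP : P j ≤ ∑ j, P j := Finset.single_le_sum (fun _ _ => Nat.zero_le _) (Finset.mem_univ j)
      exact mul_le_mul_of_nonneg_left (pow_le_pow_right₀ hone (by omega)) (hB j)

lemma smooth_compSymbol (hδ : 0 ≤ δ) (hσ : ∀ L, SymbolUpTo ρ δ L μ σ)
    (hτ : ∀ L, SymbolUpTo ρ δ L ν τ) (k : Fin n → ℤ) : SmoothOnTorus (compSymbol σ τ k) := by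
  choose C hC Q h using exists_iteratedFDeriv_bound hτ k
  have hs : ∀ η, SmoothOnTorus fun x => mFourier η x * τ (k + η) x := fun η =>
    (smoothOnTorus_mFourier η).mul ((hτ 0).smooth _)
  refine contDiff_tsum (v := fun m η => ‖mFourierCoeff (σ k) η‖ * (C m * bracket η ^ Q m))
    (fun η => (hs η).const_mul _) (fun m _ => ?_) (fun m η y _ => ?_)
  · simpa only [mul_left_comm] using (summable_mFourierCoeff_mul hδ hσ k (Q m)).mul_left (C m)
  · have c1 : ContDiffAt ℝ m (lift fun x => mFourier η x * τ (k + η) x) y :=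
      ((hs η).contDiff.of_le (by exact_mod_cast le_top)).contDiffAt
    have := iteratedFDeriv_const_smul_apply (a := mFourierCoeff (σ k) η) c1
    change ‖iteratedFDeriv ℝ m (mFourierCoeff (σ k) η •
      lift fun x => mFourier η x * τ (k + η) x) y‖ ≤ _
    rw [this, norm_smul]
    exact mul_le_mul_of_nonneg_left (h m η y) (norm_nonneg _)

lemma summable_compSymbol (hδ : 0 ≤ δ) (hσ : ∀ L, SymbolUpTo ρ δ L μ σ) (hτ : HasOrder ν τ)
    (k : Fin n → ℤ) (x : UnitAddTorus (Fin n)) :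
    Summable fun η => mFourierCoeff (σ k) η * (mFourier η x * τ (k + η) x) := by
  obtain ⟨C, hC, Q, h⟩ := hτ.exists_translate_bound
  refine Summable.of_norm_bounded
    ((summable_mFourierCoeff_mul hδ hσ k Q).mul_left (C * bracket k ^ ν)) fun η => ?_
  rw [norm_mul, norm_mul, norm_mFourier_apply, one_mul, mul_left_comm]
  exact mul_le_mul_of_nonneg_left (h k η x) (norm_nonneg _)

lemma symD_compSymbol (hδ : 0 ≤ δ) (hσ : ∀ L, SymbolUpTo ρ δ L μ σ)
    (hτ : ∀ L, SymbolUpTo ρ δ L ν τ) (j : Fin n) :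
    symD j (compSymbol σ τ) = compSymbol (symD j σ) τ + compSymbol σ (symD j τ) := by
  funext k x
  obtain ⟨C, hC, Q, h⟩ := (hτ 0).hasOrder.exists_translate_bound
  obtain ⟨B, hB, P, hb⟩ := (symbolUpTo_symD hτ j 0).hasOrder.exists_translate_bound
  have hs : ∀ η, SmoothOnTorus fun x => mFourier η x * τ (k + η) x := fun η =>
    (smoothOnTorus_mFourier η).mul ((hτ 0).smooth _)
  have hσ' := symbolUpTo_symD hσ j
  have s1 := summable_compSymbol hδ hσ' (hτ 0) k x
  have s2 := summable_compSymbol hδ hσ (symbolUpTo_symD hτ j 0) k x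
  have e : ∀ η x, torusD j (fun x => mFourier η x * τ (k + η) x) x =
      (η j : ℂ) * (mFourier η x * τ (k + η) x) + mFourier η x * symD j τ (k + η) x :=
    fun η x => congrFun (torusD_mFourier_mul ((hτ 0).smooth _) η j) x
  have hcoef : ∀ η, mFourierCoeff (symD j σ k) η = (η j : ℂ) * mFourierCoeff (σ k) η :=
    fun η => mFourierCoeff_torusD ((hσ 0).smooth k) j η
  have hu : Summable fun η => 2 * Real.pi *
      (‖mFourierCoeff (symD j σ k) η‖ * bracket η ^ Q * (C * bracket k ^ ν) +
        ‖mFourierCoeff (σ k) η‖ * bracket η ^ P * (B * bracket k ^ (ν + δ))) :=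
    (((summable_mFourierCoeff_mul hδ hσ' k Q).mul_right _).add
      ((summable_mFourierCoeff_mul hδ hσ k P).mul_right _)).mul_left _
  have hbound : ∀ η (z : UnitAddTorus (Fin n)), ‖mFourierCoeff (σ k) η *
      (2 * (Real.pi : ℂ) * Complex.I * torusD j (fun x => mFourier η x * τ (k + η) x) z)‖ ≤
      2 * Real.pi *
        (‖mFourierCoeff (symD j σ k) η‖ * bracket η ^ Q * (C * bracket k ^ ν) +
        ‖mFourierCoeff (σ k) η‖ * bracket η ^ P * (B * bracket k ^ (ν + δ))) := by
    intro η z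
    have h1 := mul_le_mul_of_nonneg_left (h k η z)
      (mul_nonneg (norm_nonneg (η j : ℂ)) (norm_nonneg (mFourierCoeff (σ k) η)))
    have h2 := mul_le_mul_of_nonneg_left (hb k η z) (norm_nonneg (mFourierCoeff (σ k) η))
    have h3 := mul_le_mul_of_nonneg_left
      (norm_add_le ((η j : ℂ) * (mFourier η z * τ (k + η) z)) (mFourier η z * symD j τ (k + η) z))
      (norm_nonneg (mFourierCoeff (σ k) η))
    rw [norm_mul (η j : ℂ), norm_mul (mFourier η z), norm_mul (mFourier η z),
      norm_mFourier_apply, one_mul, one_mul] at h3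
    rw [e, norm_mul, norm_mul, norm_mul, norm_mul, Complex.norm_real, Complex.norm_I,
      Complex.norm_ofNat, Real.norm_of_nonneg Real.pi_pos.le, mul_one, mul_left_comm, hcoef,
      norm_mul (η j : ℂ)]
    refine mul_le_mul_of_nonneg_left (h3.trans ?_) (by positivity)
    linarith
  have hd : HasDerivAt (fun t : ℝ => compSymbol σ τ k (x + Pi.single j (t : UnitAddCircle)))
      (∑' η, mFourierCoeff (σ k) η * (2 * (Real.pi : ℂ) * Complex.I *
        torusD j (fun x => mFourier η x * τ (k + η) x)
          (x + Pi.single j ((0 : ℝ) : UnitAddCircle)))) 0 :=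
    hasDerivAt_tsum (𝕜 := ℝ) (y₀ := 0) hu
      (fun η t => ((hs η).hasDerivAt j x t).const_mul _) (fun η t => hbound η _)
      (summable_compSymbol hδ hσ (hτ 0) k _) 0
  refine torusD_eq_of_hasDerivAt (hd.congr_deriv ?_)
  simp only [QuotientAddGroup.mk_zero, Pi.single_zero, add_zero, Pi.add_apply, compSymbol]
  rw [← s1.tsum_add s2, ← tsum_mul_left]
  refine tsum_congr fun η => ?_
  rw [e, hcoef]
  ring

lemma symDiff_compSymbol (hδ : 0 ≤ δ) (hσ : ∀ L, SymbolUpTo ρ δ L μ σ)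
    (hτ : ∀ L, SymbolUpTo ρ δ L ν τ) (j : Fin n) :
    symDiff j (compSymbol σ τ) = compSymbol (symDiff j σ) τ + compSymbol σ (symDiff j τ) +
      compSymbol (symDiff j σ) (symDiff j τ) := by
  funext k x
  have hσ' := symbolUpTo_symDiff hσ j
  have s1 := summable_compSymbol hδ hσ' (hτ 0) k x
  have s2 := summable_compSymbol hδ hσ (symbolUpTo_symDiff hτ j 0) k x
  have s3 := summable_compSymbol hδ hσ' (symbolUpTo_symDiff hτ j 0) k x
  have s4 := summable_compSymbol hδ hσ (hτ 0) (k + Pi.single j 1) x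
  have s5 := summable_compSymbol hδ hσ (hτ 0) k x
  simp only [symDiff, compSymbol, Pi.add_apply]
  simp only [symDiff] at s1 s2 s3
  rw [← s4.tsum_sub s5, ← s1.tsum_add s2, ← (s1.add s2).tsum_add s3]
  refine tsum_congr fun η => ?_
  have hc : mFourierCoeff (symDiff j σ k) η =
      mFourierCoeff (σ (k + Pi.single j 1)) η - mFourierCoeff (σ k) η :=
    mFourierCoeff_sub ((hσ 0).smooth _) ((hσ 0).smooth k) η
  rw [hc, add_right_comm k (Pi.single j 1) η]
  ring

end CompSymbol

/-! ### The discrete Taylor formula -/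

lemma mem_multiIndicesLT {N : ℕ} {α : Fin n → ℕ} : α ∈ multiIndicesLT n N ↔ order α < N := by
  simp only [multiIndicesLT, Finset.mem_filter, Fintype.mem_piFinset, Finset.mem_range,
    and_iff_right_iff_imp]
  exact fun h j => (Finset.single_le_sum (fun _ _ => Nat.zero_le _) (Finset.mem_univ j)).trans_lt h

/-- The binomial coefficient `η^{(α)} / α! = ∏_j (η_j choose α_j)` for `η ∈ ℤⁿ`. -/
def latticeBinom (η : Fin n → ℤ) (α : Fin n → ℕ) : ℂ :=
  ∏ j, (descPochhammer ℂ (α j)).eval (η j : ℂ) / ((α j).factorial : ℂ)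

lemma latticeBinom_eq (η : Fin n → ℤ) (α : Fin n → ℕ) : latticeBinom η α =
    (∏ j, (descPochhammer ℂ (α j)).eval (η j : ℂ)) / (multiFactorial α : ℂ) := by
  rw [latticeBinom, Finset.prod_div_distrib, multiFactorial, Nat.cast_prod]

/-- Pascal's rule for a complex upper argument. -/
lemma descPochhammer_div_factorial_succ (z : ℂ) (m : ℕ) :
    (descPochhammer ℂ (m + 1)).eval (z + 1) / ((m + 1).factorial : ℂ) =
      (descPochhammer ℂ (m + 1)).eval z / ((m + 1).factorial : ℂ) +
        (descPochhammer ℂ m).eval z / (m.factorial : ℂ) := by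
  have h := congrArg (fun p => Polynomial.eval (z + 1) p) (descPochhammer_succ_comp_X_sub_one ℂ m)
  simp only [Polynomial.eval_comp, Polynomial.eval_sub, Polynomial.eval_X, Polynomial.eval_one,
    add_sub_cancel_right, smul_eq_mul, Polynomial.eval_mul, Polynomial.eval_add,
    Polynomial.eval_natCast] at h
  have h1 : ((m : ℂ) + 1) ≠ 0 := Nat.cast_add_one_ne_zero m
  have h2 : (m.factorial : ℂ) ≠ 0 := Nat.cast_ne_zero.2 m.factorial_ne_zero
  rw [h, Nat.factorial_succ]
  push_cast
  field_simp
  ring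

lemma latticeBinom_add_single_of_eq_zero (η : Fin n → ℤ) {α : Fin n → ℕ} {j : Fin n}
    (h : α j = 0) : latticeBinom (η + Pi.single j 1) α = latticeBinom η α := by
  refine Finset.prod_congr rfl fun i _ => ?_
  by_cases hij : i = j
  · subst hij; simp [h]
  · simp [hij]

lemma latticeBinom_add_single (η : Fin n → ℤ) (γ : Fin n → ℕ) (j : Fin n) :
    latticeBinom (η + Pi.single j 1) (γ + Pi.single j 1) =
      latticeBinom η (γ + Pi.single j 1) + latticeBinom η γ := by
  have hsplit : ∀ (ζ : Fin n → ℤ) (α : Fin n → ℕ), latticeBinom ζ α =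
      (descPochhammer ℂ (α j)).eval (ζ j : ℂ) / ((α j).factorial : ℂ) *
        ∏ i ∈ Finset.univ.erase j,
          (descPochhammer ℂ (α i)).eval (ζ i : ℂ) / ((α i).factorial : ℂ) := fun ζ α =>
    (Finset.mul_prod_erase Finset.univ _ (Finset.mem_univ j)).symm
  have h1 : ∀ ζ ∈ ({η, η + Pi.single j 1} : Set (Fin n → ℤ)),
      ∀ α ∈ ({γ, γ + Pi.single j 1} : Set (Fin n → ℕ)),
      ∏ i ∈ Finset.univ.erase j,
        (descPochhammer ℂ (α i)).eval (ζ i : ℂ) / ((α i).factorial : ℂ) =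
      ∏ i ∈ Finset.univ.erase j,
        (descPochhammer ℂ (γ i)).eval (η i : ℂ) / ((γ i).factorial : ℂ) := by
    intro ζ hζ α hα
    refine Finset.prod_congr rfl fun i hi => ?_
    have hij : i ≠ j := Finset.ne_of_mem_erase hi
    rcases hζ with rfl | rfl <;> rcases hα with rfl | rfl <;> simp [hij]
  rw [hsplit, hsplit η, hsplit η, h1 (η + Pi.single j 1) (by simp) (γ + Pi.single j 1) (by simp),
    h1 η (by simp) (γ + Pi.single j 1) (by simp), ← add_mul]
  simp only [Pi.add_apply, Pi.single_eq_same, Int.cast_add, Int.cast_one]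
  rw [descPochhammer_div_factorial_succ]

lemma latticeBinom_zero_right (η : Fin n → ℤ) : latticeBinom η 0 = 1 := by
  simp [latticeBinom]

lemma latticeBinom_zero_left {α : Fin n → ℕ} (h : α ≠ 0) : latticeBinom 0 α = 0 := by
  obtain ⟨j, hj⟩ := Function.ne_iff.1 h
  refine Finset.prod_eq_zero (Finset.mem_univ j) ?_
  have h0 : (descPochhammer ℂ (α j)).eval 0 = 0 := by
    rw [descPochhammer_eval_zero, if_neg (by simpa using hj)]
  simp [h0]

/-- The remainder of the discrete Taylor expansion of `t(k + η)` about `k`, of order `N`. -/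
def taylorRem (N : ℕ) (t : (Fin n → ℤ) → ℂ) (k η : Fin n → ℤ) : ℂ :=
  t (k + η) - ∑ α ∈ multiIndicesLT n N, latticeBinom η α * multiDiff α t k

lemma taylorRem_zero_left (t : (Fin n → ℤ) → ℂ) (k η : Fin n → ℤ) :
    taylorRem 0 t k η = t (k + η) := by
  have : multiIndicesLT n 0 = ∅ := by
    ext α; simp [mem_multiIndicesLT]
  simp [taylorRem, this]

lemma taylorRem_zero_right (N : ℕ) (t : (Fin n → ℤ) → ℂ) (k : Fin n → ℤ) :
    taylorRem (N + 1) t k 0 = 0 := by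
  rw [taylorRem, Finset.sum_eq_single 0]
  · simp [latticeBinom_zero_right, multiDiff_zero]
  · intro α _ h
    rw [latticeBinom_zero_left h, zero_mul]
  · intro h
    exact absurd (mem_multiIndicesLT.2 (by simp [order])) h

/-- Differences in `η` of a Taylor remainder are Taylor remainders of one order less. -/
lemma taylorRem_add_single_sub (N : ℕ) (t : (Fin n → ℤ) → ℂ) (k η : Fin n → ℤ) (j : Fin n) :
    taylorRem (N + 1) t k (η + Pi.single j 1) - taylorRem (N + 1) t k η =
      taylorRem N (diff j t) k η := by
  have hinj : Function.Injective fun γ : Fin n → ℕ => γ + Pi.single j 1 :=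
    add_left_injective _
  have key : ∑ α ∈ multiIndicesLT n (N + 1),
      (latticeBinom (η + Pi.single j 1) α - latticeBinom η α) * multiDiff α t k =
      ∑ γ ∈ multiIndicesLT n N, latticeBinom η γ * multiDiff γ (diff j t) k := by
    rw [← Finset.sum_subset (s₁ := (multiIndicesLT n N).image fun γ => γ + Pi.single j 1),
      Finset.sum_image hinj.injOn]
    · refine Finset.sum_congr rfl fun γ _ => ?_
      rw [latticeBinom_add_single, multiDiff_diff, add_sub_cancel_left]
    · intro α hα
      obtain ⟨γ, hγ, rfl⟩ := Finset.mem_image.1 hα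
      rw [mem_multiIndicesLT] at hγ ⊢
      rw [order_add_single]
      omega
    · intro α hα hn
      have h0 : α j = 0 := by
        by_contra h
        have hα' : α - Pi.single j 1 + Pi.single j 1 = α := by
          funext i
          by_cases hij : i = j
          · subst hij; simp; omega
          · simp [hij]
        refine hn (Finset.mem_image.2 ⟨α - Pi.single j 1, ?_, hα'⟩)
        rw [mem_multiIndicesLT] at hα ⊢
        rw [← hα', order_add_single] at hα
        omega
      rw [latticeBinom_add_single_of_eq_zero η h0, sub_self, zero_mul]
  rw [taylorRem, taylorRem, taylorRem, ← key, ← add_assoc]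
  simp only [sub_mul, Finset.sum_sub_distrib, diff]
  ring

/-- A function on the lattice that vanishes at `0` is controlled by its differences along a
coordinatewise path from `0`. -/
lemma norm_le_of_norm_diff_le {F : (Fin n → ℤ) → ℂ} (h0 : F 0 = 0) {B : ℝ} {η : Fin n → ℤ}
    (hF : ∀ j ξ, (∀ i, |ξ i| ≤ |η i|) → ‖F (ξ + Pi.single j 1) - F ξ‖ ≤ B) :
    ‖F η‖ ≤ B * ∑ i, |(η i : ℝ)| := by
  have key : ∀ (s : ℕ) (ξ : Fin n → ℤ), (∀ i, |ξ i| ≤ |η i|) → ∑ i, (ξ i).natAbs = s →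
      ‖F ξ‖ ≤ B * s := by
    intro s
    induction s with
    | zero =>
      intro ξ _ hs
      have : ξ = 0 := by
        funext i
        have := (Finset.sum_eq_zero_iff.1 hs) i (Finset.mem_univ i)
        simpa using this
      simp [this, h0]
    | succ s ih =>
      intro ξ hξ hs
      obtain ⟨j, hj⟩ : ∃ j, ξ j ≠ 0 := by
        by_contra hne
        push Not at hne
        simp [hne] at hs
      have hsum : ∀ ζ : Fin n → ℤ, (∀ i, i ≠ j → ζ i = ξ i) →
          (ζ j).natAbs + 1 = (ξ j).natAbs → ∑ i, (ζ i).natAbs = s := by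
        intro ζ h1 h2
        rw [← Finset.add_sum_erase _ _ (Finset.mem_univ j)] at hs ⊢
        have h3 : ∑ i ∈ Finset.univ.erase j, (ζ i).natAbs =
            ∑ i ∈ Finset.univ.erase j, (ξ i).natAbs :=
          Finset.sum_congr rfl fun i hi => by rw [h1 i (Finset.ne_of_mem_erase hi)]
        omega
      have hbox : ∀ ζ : Fin n → ℤ, (∀ i, i ≠ j → ζ i = ξ i) →
          (ζ j).natAbs + 1 = (ξ j).natAbs → ∀ i, |ζ i| ≤ |η i| := by
        intro ζ h1 h2 i
        refine le_trans ?_ (hξ i)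
        by_cases hij : i = j
        · rw [hij, Int.abs_eq_natAbs, Int.abs_eq_natAbs]; omega
        · rw [h1 i hij]
      push_cast
      rcases lt_or_gt_of_ne hj with hneg | hpos
      · have h1 : ∀ i, i ≠ j → (ξ + Pi.single j 1 : Fin n → ℤ) i = ξ i := fun i hi => by simp [hi]
        have h2 : ((ξ + Pi.single j 1 : Fin n → ℤ) j).natAbs + 1 = (ξ j).natAbs := by
          simp; omega
        have h3 := ih _ (hbox _ h1 h2) (hsum _ h1 h2)
        have h4 := hF j ξ hξ
        calc ‖F ξ‖ = ‖F (ξ + Pi.single j 1) - (F (ξ + Pi.single j 1) - F ξ)‖ := by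
              rw [sub_sub_cancel]
          _ ≤ _ := norm_sub_le _ _
          _ ≤ B * (s + 1) := by linarith
      · have h1 : ∀ i, i ≠ j → (ξ - Pi.single j 1 : Fin n → ℤ) i = ξ i := fun i hi => by simp [hi]
        have h2 : ((ξ - Pi.single j 1 : Fin n → ℤ) j).natAbs + 1 = (ξ j).natAbs := by
          simp; omega
        have h3 := ih _ (hbox _ h1 h2) (hsum _ h1 h2)
        have h4 := hF j (ξ - Pi.single j 1) (hbox _ h1 h2)
        rw [sub_add_cancel] at h4
        calc ‖F ξ‖ = ‖F (ξ - Pi.single j 1) + (F ξ - F (ξ - Pi.single j 1))‖ := by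
              rw [add_sub_cancel]
          _ ≤ _ := norm_add_le _ _
          _ ≤ B * (s + 1) := by linarith
  have h := key _ η (fun i => le_rfl) rfl
  simpa using h

/-- The remainder of order `N` is bounded by the differences of order `N` on the box spanned by
`η`. -/
lemma norm_taylorRem_le (N : ℕ) (t : (Fin n → ℤ) → ℂ) (k η : Fin n → ℤ) {A : ℝ} (hA : 0 ≤ A)
    (h : ∀ α, order α = N → ∀ ξ : Fin n → ℤ, (∀ i, |ξ i| ≤ |η i|) →
      ‖multiDiff α t (k + ξ)‖ ≤ A) :
    ‖taylorRem N t k η‖ ≤ A * (∑ i, |(η i : ℝ)|) ^ N := by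
  induction N generalizing t η with
  | zero =>
    have := h 0 (by simp [order]) η fun i => le_rfl
    rw [multiDiff_zero] at this
    simpa [taylorRem_zero_left] using this
  | succ N ih =>
    have h1 := norm_le_of_norm_diff_le (F := taylorRem (N + 1) t k)
      (B := A * (∑ i, |(η i : ℝ)|) ^ N) (η := η) (taylorRem_zero_right N t k) fun j ξ hξ => by
        rw [taylorRem_add_single_sub]
        refine (ih (diff j t) ξ fun α hα ζ hζ => ?_).trans ?_
        · rw [multiDiff_diff]
          exact h _ (by rw [order_add_single, hα]) ζ fun i => (hζ i).trans (hξ i)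
        · refine mul_le_mul_of_nonneg_left (pow_le_pow_left₀ (by positivity)
            (Finset.sum_le_sum fun i _ => ?_) N) hA
          exact_mod_cast hξ i
    exact h1.trans (le_of_eq (by ring))

/-! ### The remainder of the asymptotic expansion -/

/-- Either `ξ` is small compared with `k`, and `k + ξ` is comparable with `k`, or `k` is
dominated by `η`, and powers of `1 + |k|` can be traded for powers of `1 + |η|`. -/
lemma bracket_add_rpow_le_of_le {s : ℝ} {T : ℕ} (hT : |s| ≤ T) {k ξ η : Fin n → ℤ}
    (h : bracket ξ ≤ bracket η) : bracket (k + ξ) ^ s ≤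
      2 ^ T * bracket k ^ s * (1 + bracket η ^ T * bracket k ^ (|s| - T)) := by
  have hk := bracket_pos k
  have hη := bracket_pos η
  have hξ := bracket_pos ξ
  have hkξ := bracket_pos (k + ξ)
  have e1 : bracket k = 1 + latticeNorm k := rfl
  have e2 : bracket ξ = 1 + latticeNorm ξ := rfl
  have e3 : bracket (k + ξ) = 1 + latticeNorm (k + ξ) := rfl
  have hk0 := latticeNorm_nonneg k
  have hξ0 := latticeNorm_nonneg ξ
  have two_pow : (2 : ℝ) ^ |s| ≤ 2 ^ T := by
    rw [← Real.rpow_natCast]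
    exact Real.rpow_le_rpow_of_exponent_le one_le_two hT
  rcases le_or_gt (2 * latticeNorm ξ) (bracket k) with hnear | hfar
  · have hup : bracket (k + ξ) ≤ 2 * bracket k := by
      have := latticeNorm_add_le k ξ
      linarith
    have hlow : bracket k ≤ 2 * bracket (k + ξ) := by
      have := latticeNorm_add_le (k + ξ) (-ξ)
      rw [add_neg_cancel_right, latticeNorm_neg] at this
      linarith
    have hmain : bracket (k + ξ) ^ s ≤ 2 ^ |s| * bracket k ^ s := by
      rcases le_total 0 s with hs | hs
      · rw [abs_of_nonneg hs, ← Real.mul_rpow zero_le_two hk.le]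
        exact Real.rpow_le_rpow hkξ.le hup hs
      · rw [abs_of_nonpos hs]
        have := Real.rpow_le_rpow_of_nonpos hk hlow hs
        rw [Real.mul_rpow zero_le_two hkξ.le] at this
        calc bracket (k + ξ) ^ s = 2 ^ (-s) * (2 ^ s * bracket (k + ξ) ^ s) := by
              rw [← mul_assoc, ← Real.rpow_add two_pos]; simp
          _ ≤ _ := by gcongr
    have hpos := bracket_rpow_pos k s
    have hpos2 := bracket_rpow_pos k (|s| - T)
    calc bracket (k + ξ) ^ s ≤ 2 ^ T * bracket k ^ s * 1 := by
          rw [mul_one]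
          exact hmain.trans (by gcongr)
      _ ≤ _ := by
          gcongr
          have : 0 ≤ bracket η ^ T * bracket k ^ (|s| - T) := by positivity
          linarith
  · have hkη : bracket k ≤ 2 * bracket η := by linarith
    have hTs : 0 ≤ (T : ℝ) - |s| := by linarith
    have h1 : bracket k ^ ((T : ℝ) - |s|) ≤ 2 ^ T * bracket η ^ ((T : ℝ) - |s|) := by
      refine (Real.rpow_le_rpow hk.le hkη hTs).trans ?_
      rw [Real.mul_rpow zero_le_two hη.le]
      have := bracket_rpow_pos η ((T : ℝ) - |s|)
      gcongr
      rw [← Real.rpow_natCast]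
      exact Real.rpow_le_rpow_of_exponent_le one_le_two (by linarith [abs_nonneg s])
    have hpos := bracket_rpow_pos k s
    have hpos2 := bracket_rpow_pos k (|s| - T)
    have hpos3 := bracket_rpow_pos η |s|
    have h2 : bracket η ^ |s| ≤ 2 ^ T * (bracket η ^ T * bracket k ^ (|s| - T)) := by
      calc bracket η ^ |s|
          = bracket η ^ |s| * (bracket k ^ ((T : ℝ) - |s|) * bracket k ^ (|s| - T)) := by
            rw [← bracket_rpow_add]; simp
        _ ≤ bracket η ^ |s| * (2 ^ T * bracket η ^ ((T : ℝ) - |s|) * bracket k ^ (|s| - T)) := by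
            gcongr
        _ = 2 ^ T * ((bracket η ^ |s| * bracket η ^ ((T : ℝ) - |s|)) * bracket k ^ (|s| - T)) := by
            ring
        _ = _ := by
            rw [← bracket_rpow_add, add_sub_cancel, Real.rpow_natCast]
    calc bracket (k + ξ) ^ s ≤ bracket k ^ s * bracket ξ ^ |s| := bracket_add_rpow_le k ξ s
      _ ≤ bracket k ^ s * bracket η ^ |s| := by gcongr
      _ ≤ bracket k ^ s * (2 ^ T * (bracket η ^ T * bracket k ^ (|s| - T))) := by gcongr
      _ = 2 ^ T * bracket k ^ s * (bracket η ^ T * bracket k ^ (|s| - T)) := by ring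
      _ ≤ _ := by gcongr; linarith

/-- The difference of the composition symbol and the partial sum of its expansion. -/
def compRem (N : ℕ) (σ τ : (Fin n → ℤ) → UnitAddTorus (Fin n) → ℂ) :
    (Fin n → ℤ) → UnitAddTorus (Fin n) → ℂ :=
  compSymbol σ τ - ∑ α ∈ multiIndicesLT n N, compTerm σ τ α

section Remainder

variable {ρ δ μ ν : ℝ} {σ τ : (Fin n → ℤ) → UnitAddTorus (Fin n) → ℂ}

lemma hasSum_compRem (hδ : 0 ≤ δ) (hσ : ∀ L, SymbolUpTo ρ δ L μ σ)
    (hτ : ∀ L, SymbolUpTo ρ δ L ν τ) (N : ℕ) (k : Fin n → ℤ) (x : UnitAddTorus (Fin n)) :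
    HasSum (fun η => mFourierCoeff (σ k) η * (mFourier η x * taylorRem N (fun m => τ m x) k η))
      (compRem N σ τ k x) := by
  have h1 := (summable_compSymbol hδ hσ (hτ 0) k x).hasSum
  have h2 : ∀ α, HasSum (fun η => mFourierCoeff (σ k) η *
      (mFourier η x * (latticeBinom η α * multiDiff α (fun m => τ m x) k)))
      (compTerm σ τ α k x) := by
    intro α
    have h3 := hasSum_mFourier (((hσ 0).smooth k).multiTorusD α)
      (summable_mFourierCoeff hδ (symbolUpTo_multiSymD hδ hσ α) k) x
    have h4 := (h3.mul_left (1 / (multiFactorial α : ℂ))).mul_right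
      (multiDiff α (fun m => τ m x) k)
    refine h4.congr_fun fun η => ?_
    rw [mFourierCoeff_multiTorusD ((hσ 0).smooth k), latticeBinom_eq]
    ring
  have h5 := h1.sub (hasSum_sum fun α (_ : α ∈ multiIndicesLT n N) => h2 α)
  have e : compRem N σ τ k x = (∑' η, mFourierCoeff (σ k) η * (mFourier η x * τ (k + η) x)) -
      ∑ α ∈ multiIndicesLT n N, compTerm σ τ α k x := by
    simp only [compRem, Pi.sub_apply, Finset.sum_apply]
    rfl
  rw [e]
  refine h5.congr_fun fun η => ?_
  rw [taylorRem, mul_sub, mul_sub, Finset.mul_sum, Finset.mul_sum]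

lemma smooth_compTerm (hσ : ∀ k, SmoothOnTorus (σ k)) (hτ : ∀ k, SmoothOnTorus (τ k))
    (α : Fin n → ℕ) (k : Fin n → ℤ) : SmoothOnTorus (compTerm σ τ α k) := by
  rw [compTerm_eq]
  exact (((hσ k).multiTorusD α).mul (smooth_multiSymDiff hτ α k)).const_mul _

end Remainder

/-! ### The expansion holds in the symbol class -/

section RemainderSymbol

variable {ρ δ μ ν : ℝ} {σ τ : (Fin n → ℤ) → UnitAddTorus (Fin n) → ℂ}

lemma smooth_sum {ι : Type*} {s : Finset ι} {f : ι → (Fin n → ℤ) → UnitAddTorus (Fin n) → ℂ}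
    (h : ∀ i ∈ s, ∀ k, SmoothOnTorus (f i k)) (k : Fin n → ℤ) :
    SmoothOnTorus ((∑ i ∈ s, f i) k) := by
  rw [Finset.sum_apply]
  exact Finset.sum_induction (fun i => f i k) SmoothOnTorus (fun _ _ => SmoothOnTorus.add)
    (smoothOnTorus_const 0) fun i hi => h i hi k

lemma symD_sum {ι : Type*} {s : Finset ι} {f : ι → (Fin n → ℤ) → UnitAddTorus (Fin n) → ℂ}
    (h : ∀ i ∈ s, ∀ k, SmoothOnTorus (f i k)) (j : Fin n) :
    symD j (∑ i ∈ s, f i) = ∑ i ∈ s, symD j (f i) := by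
  classical
  induction s using Finset.induction_on with
  | empty =>
    have := symD_const_smul (σ := (0 : (Fin n → ℤ) → UnitAddTorus (Fin n) → ℂ))
      (fun _ => smoothOnTorus_const 0) 0 j
    simpa using this
  | insert i s hi ih =>
    have hs : ∀ l ∈ s, ∀ k, SmoothOnTorus (f l k) := fun l hl => h l (Finset.mem_insert_of_mem hl)
    rw [Finset.sum_insert hi, Finset.sum_insert hi,
      symD_add (h i (Finset.mem_insert_self i s)) (smooth_sum hs), ih hs]

lemma symDiff_sum {ι : Type*} {s : Finset ι} {f : ι → (Fin n → ℤ) → UnitAddTorus (Fin n) → ℂ}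
    (j : Fin n) : symDiff j (∑ i ∈ s, f i) = ∑ i ∈ s, symDiff j (f i) := by
  funext k x
  simp only [symDiff, Finset.sum_apply, Finset.sum_sub_distrib]

lemma compRem_eq (N : ℕ) : compRem N σ τ =
    compSymbol σ τ + (-1 : ℂ) • ∑ α ∈ multiIndicesLT n N, compTerm σ τ α := by
  rw [compRem, neg_one_smul, sub_eq_add_neg]

lemma symD_compRem (hδ : 0 ≤ δ) (hσ : ∀ L, SymbolUpTo ρ δ L μ σ)
    (hτ : ∀ L, SymbolUpTo ρ δ L ν τ) (N : ℕ) (j : Fin n) :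
    symD j (compRem N σ τ) = compRem N (symD j σ) τ + compRem N σ (symD j τ) := by
  have hs := (hσ 0).smooth
  have ht := (hτ 0).smooth
  have h1 : ∀ α ∈ multiIndicesLT n N, ∀ k, SmoothOnTorus (compTerm σ τ α k) :=
    fun α _ => smooth_compTerm hs ht α
  have h2 := smooth_sum h1
  have h3 : ∀ k, SmoothOnTorus
      (((-1 : ℂ) • ∑ α ∈ multiIndicesLT n N, compTerm σ τ α) k) :=
    fun k => (h2 k).const_mul (-1)
  rw [compRem_eq, symD_add (smooth_compSymbol hδ hσ hτ) h3,
    symD_const_smul h2, symD_sum h1, symD_compSymbol hδ hσ hτ, compRem_eq, compRem_eq]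
  simp only [symD_compTerm hs ht, Finset.sum_add_distrib, smul_add]
  abel

lemma symDiff_compRem (hδ : 0 ≤ δ) (hσ : ∀ L, SymbolUpTo ρ δ L μ σ)
    (hτ : ∀ L, SymbolUpTo ρ δ L ν τ) (N : ℕ) (j : Fin n) :
    symDiff j (compRem N σ τ) = compRem N (symDiff j σ) τ + compRem N σ (symDiff j τ) +
      compRem N (symDiff j σ) (symDiff j τ) := by
  rw [compRem_eq, symDiff_add, symDiff_const_smul, symDiff_sum, symDiff_compSymbol hδ hσ hτ,
    compRem_eq, compRem_eq, compRem_eq]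
  simp only [symDiff_compTerm (hσ 0).smooth, Finset.sum_add_distrib, smul_add]
  abel

/-- The size of the remainder. Summing the rapidly decaying Fourier coefficients over `η ∈ ℤⁿ`
costs `2n` powers of `1 + |η|`, hence the loss `2nδ` in the order. -/
lemma hasOrder_compRem (hδ : 0 ≤ δ) (hδ1 : δ < 1) (hσ : ∀ L, SymbolUpTo ρ δ L μ σ)
    (hτ : ∀ L, SymbolUpTo ρ δ L ν τ) (N : ℕ) :
    HasOrder (μ + ν - N * (ρ - δ) + 2 * n * δ) (compRem N σ τ) := by
  refine ⟨fun k => ?_, ?_⟩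
  · rw [compRem_eq]
    exact (smooth_compSymbol hδ hσ hτ k).add
      ((smooth_sum (fun α _ => smooth_compTerm (hσ 0).smooth (hτ 0).smooth α) k).const_mul (-1))
  obtain ⟨s, hs⟩ : ∃ s, s = ν - ρ * N := ⟨_, rfl⟩
  -- far from `k`, the exponent `T` is large enough for the gain `(1 - δ) T` to absorb `|s|`
  obtain ⟨T, hT⟩ := exists_nat_ge (|s| / (1 - δ))
  have hT1 : |s| ≤ T * (1 - δ) := (div_le_iff₀ (by linarith)).1 hT
  have hT2 : |s| ≤ T := hT1.trans (by
    have : (0 : ℝ) ≤ T := Nat.cast_nonneg T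
    nlinarith)
  choose A hA hA' using fun α => (symbolUpTo_multiSymDiff hτ α 0).hasOrder.2
  obtain ⟨A0, hA0⟩ : ∃ A0, A0 = ∑ α ∈ multiIndicesLT n (N + 1), A α := ⟨_, rfl⟩
  have hA0p : 0 ≤ A0 := hA0 ▸ Finset.sum_nonneg fun α _ => hA α
  obtain ⟨C₁, hC₁, h₁⟩ := exists_mFourierCoeff_bound hδ (N + 2 * n) (hσ _)
  obtain ⟨C₂, hC₂, h₂⟩ := exists_mFourierCoeff_bound hδ (N + T + 2 * n) (hσ _)
  have hrem : ∀ k η x, ‖taylorRem N (fun m => τ m x) k η‖ ≤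
      A0 * (2 ^ T * bracket k ^ s * (1 + bracket η ^ T * bracket k ^ (|s| - T))) *
        (n * bracket η) ^ N := by
    intro k η x
    have p1 := bracket_rpow_pos k s
    have p2 := bracket_rpow_pos k (|s| - T)
    have p3 := bracket_pos η
    refine (norm_taylorRem_le N _ k η (A := A0 * (2 ^ T * bracket k ^ s *
      (1 + bracket η ^ T * bracket k ^ (|s| - T)))) (by positivity) fun α hα ξ hξ => ?_).trans ?_
    · refine (hA' α (k + ξ) x).trans ?_
      have hb : bracket ξ ≤ bracket η := add_le_add_right (latticeNorm_mono hξ) 1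
      have hle : A α ≤ A0 := hA0 ▸ Finset.single_le_sum (fun α _ => hA α)
        (mem_multiIndicesLT.2 (by omega))
      have := bracket_add_rpow_le_of_le hT2 (k := k) hb
      rw [hα, ← hs]
      exact mul_le_mul hle this (bracket_rpow_pos _ _).le hA0p
    · gcongr
      calc ∑ i, |(η i : ℝ)| ≤ ∑ _i : Fin n, bracket η :=
            Finset.sum_le_sum fun i _ => abs_apply_le_bracket η i
        _ = n * bracket η := by simp
  refine ⟨A0 * 2 ^ T * n ^ N * (C₁ + C₂) * ∑' η : Fin n → ℤ, (bracket η ^ (2 * n))⁻¹,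
    mul_nonneg (by positivity) (tsum_nonneg fun η => by have := bracket_pos η; positivity),
    fun k x => ?_⟩
  have hbound := (summable_bracket (n := n)).hasSum.mul_left
    (A0 * 2 ^ T * n ^ N * (C₁ + C₂) * bracket k ^ (μ + ν - N * (ρ - δ) + 2 * n * δ))
  refine ((hasSum_compRem hδ hσ hτ N k x).norm_le_of_bounded hbound fun η => ?_).trans
    (le_of_eq (by ring))
  have p1 := bracket_rpow_pos k s
  have p2 := bracket_rpow_pos k (|s| - T)
  have p3 := bracket_pos η
  have hw : 0 < bracket η ^ (2 * n) := pow_pos p3 _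
  obtain ⟨E, hE⟩ : ∃ E, E = μ + ν - N * (ρ - δ) + 2 * n * δ := ⟨_, rfl⟩
  rw [← hE]
  have b1 : bracket k ^ s * (‖mFourierCoeff (σ k) η‖ * bracket η ^ N) ≤
      C₁ * bracket k ^ E * (bracket η ^ (2 * n))⁻¹ := by
    rw [← div_eq_mul_inv, le_div_iff₀ hw]
    calc _ = bracket k ^ s * (‖mFourierCoeff (σ k) η‖ * bracket η ^ (N + 2 * n)) := by ring
      _ ≤ bracket k ^ s * (C₁ * bracket k ^ (μ + δ * (N + 2 * n : ℕ))) :=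
        mul_le_mul_of_nonneg_left (h₁ k η) p1.le
      _ = C₁ * (bracket k ^ s * bracket k ^ (μ + δ * (N + 2 * n : ℕ))) := by ring
      _ = C₁ * bracket k ^ E := by
        rw [← bracket_rpow_add, hE, hs]
        congr 2
        push_cast; ring
  have b2 : bracket k ^ s * bracket k ^ (|s| - T) *
      (‖mFourierCoeff (σ k) η‖ * bracket η ^ (N + T)) ≤
      C₂ * bracket k ^ E * (bracket η ^ (2 * n))⁻¹ := by
    rw [← div_eq_mul_inv, le_div_iff₀ hw]
    calc _ = bracket k ^ s * bracket k ^ (|s| - T) *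
          (‖mFourierCoeff (σ k) η‖ * bracket η ^ (N + T + 2 * n)) := by ring
      _ ≤ bracket k ^ s * bracket k ^ (|s| - T) *
          (C₂ * bracket k ^ (μ + δ * (N + T + 2 * n : ℕ))) :=
        mul_le_mul_of_nonneg_left (h₂ k η) (by positivity)
      _ = C₂ * (bracket k ^ s * bracket k ^ (|s| - T) *
          bracket k ^ (μ + δ * (N + T + 2 * n : ℕ))) := by ring
      _ ≤ C₂ * bracket k ^ E := by
        rw [← bracket_rpow_add, ← bracket_rpow_add, hE, hs]
        refine mul_le_mul_of_nonneg_left (bracket_rpow_mono k ?_) hC₂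
        rw [hs] at hT1
        push_cast
        linarith
  rw [norm_mul, norm_mul, norm_mFourier_apply, one_mul]
  calc ‖mFourierCoeff (σ k) η‖ * ‖taylorRem N (fun m => τ m x) k η‖
      ≤ ‖mFourierCoeff (σ k) η‖ *
        (A0 * (2 ^ T * bracket k ^ s * (1 + bracket η ^ T * bracket k ^ (|s| - T))) *
          (n * bracket η) ^ N) := mul_le_mul_of_nonneg_left (hrem k η x) (norm_nonneg _)
    _ = A0 * 2 ^ T * n ^ N * (bracket k ^ s * (‖mFourierCoeff (σ k) η‖ * bracket η ^ N) +
        bracket k ^ s * bracket k ^ (|s| - T) *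
          (‖mFourierCoeff (σ k) η‖ * bracket η ^ (N + T))) := by ring
    _ ≤ A0 * 2 ^ T * n ^ N * (C₁ * bracket k ^ E * (bracket η ^ (2 * n))⁻¹ +
        C₂ * bracket k ^ E * (bracket η ^ (2 * n))⁻¹) :=
      mul_le_mul_of_nonneg_left (add_le_add b1 b2) (by positivity)
    _ = _ := by ring

/-- The remainder obeys the same Leibniz rules as a product, so the size estimate
`hasOrder_compRem` for all pairs of symbols propagates to all derivatives and differences. -/
lemma symbolUpTo_compRem_aux (hδ : 0 ≤ δ) (hδ1 : δ < 1) (hρ : 0 ≤ ρ) (N L : ℕ)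
    (hσ : ∀ L, SymbolUpTo ρ δ L μ σ) (hτ : ∀ L, SymbolUpTo ρ δ L ν τ) :
    SymbolUpTo ρ δ L (μ + ν - N * (ρ - δ) + 2 * n * δ) (compRem N σ τ) := by
  induction L generalizing μ ν σ τ with
  | zero => exact hasOrder_compRem hδ hδ1 hσ hτ N
  | succ L ih =>
    refine ⟨hasOrder_compRem hδ hδ1 hσ hτ N, fun j => ⟨?_, ?_⟩⟩
    · rw [symD_compRem hδ hσ hτ]
      exact ((ih (symbolUpTo_symD hσ j) hτ).mono (by linarith)).add
        ((ih hσ (symbolUpTo_symD hτ j)).mono (by linarith))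
    · rw [symDiff_compRem hδ hσ hτ]
      exact (((ih (symbolUpTo_symDiff hσ j) hτ).mono (by linarith)).add
        ((ih hσ (symbolUpTo_symDiff hτ j)).mono (by linarith))).add
        ((ih (symbolUpTo_symDiff hσ j) (symbolUpTo_symDiff hτ j)).mono (by linarith))

/-- The remainder of order `N` is a symbol of the expected order: the loss of order in
`symbolUpTo_compRem_aux` is made up for by expanding further. -/
lemma symbolUpTo_compRem (hδ : 0 ≤ δ) (hδρ : δ < ρ) (hρ : ρ ≤ 1)
    (hσ : ∀ L, SymbolUpTo ρ δ L μ σ) (hτ : ∀ L, SymbolUpTo ρ δ L ν τ) (N L : ℕ) :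
    SymbolUpTo ρ δ L (μ + ν - N * (ρ - δ)) (compRem N σ τ) := by
  have hρδ : 0 < ρ - δ := sub_pos.2 hδρ
  obtain ⟨P, hP⟩ := exists_nat_ge (2 * n * δ / (ρ - δ))
  rw [div_le_iff₀ hρδ] at hP
  have h1 := (symbolUpTo_compRem_aux hδ (hδρ.trans_le hρ) (hδ.trans hδρ.le) (N + P) L hσ hτ).mono
    (ν := μ + ν - N * (ρ - δ)) (by push_cast; linarith)
  have hsub : multiIndicesLT n N ⊆ multiIndicesLT n (N + P) := fun α hα => by
    rw [mem_multiIndicesLT] at hα ⊢; omega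
  have e : compRem N σ τ = compRem (N + P) σ τ +
      ∑ α ∈ multiIndicesLT n (N + P) \ multiIndicesLT n N, compTerm σ τ α := by
    rw [compRem, compRem, ← Finset.sum_sdiff hsub]
    abel
  rw [e]
  refine h1.add (SymbolUpTo.sum fun α hα => ?_)
  refine (symbolUpTo_compTerm hδ (hδ.trans hδρ.le) hσ hτ α L).mono ?_
  have hα' : N ≤ order α := by
    by_contra h
    exact (Finset.mem_sdiff.1 hα).2 (mem_multiIndicesLT.2 (not_le.1 h))
  have : (N : ℝ) * (ρ - δ) ≤ order α * (ρ - δ) := by gcongr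
  linarith

end RemainderSymbol

/-! ### Quantization on the Schwartz space -/

lemma IsSchwartz.exists_bound {f : (Fin n → ℤ) → ℂ} (hf : IsSchwartz f) (M : ℕ) :
    ∃ C, 0 ≤ C ∧ ∀ k, ‖f k‖ * bracket k ^ M ≤ C := by
  obtain ⟨C, hC⟩ := hf M
  have h : ∀ k, ‖f k‖ * bracket k ^ M ≤ C := fun k => by
    have hk := hC k
    change _ ≤ C * bracket k ^ (-(M : ℝ)) at hk
    have hp : 0 < bracket k ^ M := pow_pos (bracket_pos k) M
    rw [Real.rpow_neg (bracket_pos k).le, Real.rpow_natCast, ← div_eq_mul_inv,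
      le_div_iff₀ hp] at hk
    exact hk
  exact ⟨C, le_trans (mul_nonneg (norm_nonneg _) (pow_nonneg (bracket_pos 0).le M)) (h 0), h⟩

lemma isSchwartz_of_exists_bound {f : (Fin n → ℤ) → ℂ}
    (h : ∀ M : ℕ, ∃ C, ∀ k, ‖f k‖ * bracket k ^ M ≤ C) : IsSchwartz f := by
  intro M
  obtain ⟨C, hC⟩ := h ⌈M⌉₊
  refine ⟨C, fun k => ?_⟩
  change _ ≤ C * bracket k ^ (-M)
  have hp : 0 < bracket k ^ M := bracket_rpow_pos k M
  rw [Real.rpow_neg (bracket_pos k).le, ← div_eq_mul_inv, le_div_iff₀ hp]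
  refine le_trans (mul_le_mul_of_nonneg_left ?_ (norm_nonneg _)) (hC k)
  rw [← Real.rpow_natCast]
  exact bracket_rpow_mono k (Nat.le_ceil M)

lemma IsSchwartz.summable {f : (Fin n → ℤ) → ℂ} (hf : IsSchwartz f) (M : ℕ) :
    Summable fun k => ‖f k‖ * bracket k ^ M := by
  obtain ⟨C, -, hC⟩ := hf.exists_bound (M + 2 * n)
  refine Summable.of_nonneg_of_le (fun k => by have := bracket_pos k; positivity) (fun k => ?_)
    (summable_bracket.mul_left C)
  have hp : 0 < bracket k ^ (2 * n) := pow_pos (bracket_pos k) _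
  rw [← div_eq_mul_inv, le_div_iff₀ hp, mul_assoc, ← pow_add]
  exact hC k

lemma IsSchwartz.summable_norm {f : (Fin n → ℤ) → ℂ} (hf : IsSchwartz f) :
    Summable fun k => ‖f k‖ := by
  simpa using hf.summable 0

lemma continuous_latticeFourier {f : (Fin n → ℤ) → ℂ} (hf : IsSchwartz f) :
    Continuous (latticeFourier f) :=
  continuous_tsum (fun k => (mFourier (-k)).continuous.mul continuous_const) hf.summable_norm
    fun k x => by rw [norm_mul, norm_mFourier_apply, one_mul]

lemma norm_latticeFourier_le {f : (Fin n → ℤ) → ℂ} (hf : IsSchwartz f)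
    (x : UnitAddTorus (Fin n)) : ‖latticeFourier f x‖ ≤ ∑' k, ‖f k‖ :=
  tsum_of_norm_bounded hf.summable_norm.hasSum fun k => by
    rw [norm_mul, norm_mFourier_apply, one_mul]

section Quantization

variable {ρ δ μ ν : ℝ} {σ τ : (Fin n → ℤ) → UnitAddTorus (Fin n) → ℂ} {f : (Fin n → ℤ) → ℂ}

/-- The quantization is the operator with matrix entries `σ̂(k, m - k)`. -/
lemma hasSum_Op (hσ : ∀ k, SmoothOnTorus (σ k)) (hf : IsSchwartz f) (k : Fin n → ℤ) :
    HasSum (fun m => f m * mFourierCoeff (σ k) (m - k)) (Op σ f k) := by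
  obtain ⟨C, hC⟩ := (hσ k).exists_bound
  have hint : ∀ m, Integrable (fun x => mFourier k x * σ k x * (mFourier (-m) x * f m))
      (torusMeasure n) := fun m => integrable_of_continuous
    (((mFourier k).continuous.mul (hσ k).continuous).mul
      ((mFourier (-m)).continuous.mul continuous_const))
  have hsum : Summable fun m =>
      ∫ x, ‖mFourier k x * σ k x * (mFourier (-m) x * f m)‖ ∂(torusMeasure n) := by
    refine Summable.of_nonneg_of_le (fun m => integral_nonneg fun x => norm_nonneg _)
      (fun m => ?_) (hf.summable_norm.mul_left C)
    refine (Real.le_norm_self _).trans (norm_integral_le (C := C * ‖f m‖) fun x => ?_)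
    rw [norm_norm, norm_mul, norm_mul, norm_mul, norm_mFourier_apply, norm_mFourier_apply,
      one_mul, one_mul]
    exact mul_le_mul_of_nonneg_right (hC x) (norm_nonneg _)
  have h := hasSum_integral_of_summable_integral_norm hint hsum
  have e : ∫ x, ∑' m, mFourier k x * σ k x * (mFourier (-m) x * f m) ∂(torusMeasure n) =
      Op σ f k := by
    simp only [tsum_mul_left]
    rfl
  rw [e] at h
  refine h.congr_fun fun m => ?_
  rw [mFourierCoeff_eq, ← integral_const_mul]
  congr 1
  funext x
  have : mFourier (-(m - k)) x = mFourier k x * mFourier (-m) x := by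
    rw [← mFourier_add]
    congr 2
    abel
  rw [this]
  ring

/-- Decay of the matrix entries off the diagonal in `M` powers beats the growth
`(1 + |k|)^{μ + δM}` once `(1 - δ) M ≥ μ + P`; this uses `δ < 1`. -/
lemma isSchwartz_Op (hδ : 0 ≤ δ) (hδ1 : δ < 1) (hσ : ∀ L, SymbolUpTo ρ δ L μ σ)
    (hf : IsSchwartz f) : IsSchwartz (Op σ f) := by
  refine isSchwartz_of_exists_bound fun P => ?_
  obtain ⟨M, hM⟩ := exists_nat_ge ((μ + P) / (1 - δ))
  rw [div_le_iff₀ (by linarith)] at hM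
  obtain ⟨C, hC, h⟩ := exists_mFourierCoeff_bound hδ M (hσ M)
  refine ⟨C * ∑' m, ‖f m‖ * bracket m ^ M, fun k => ?_⟩
  have hs := (hf.summable M).hasSum.mul_left C
  have hP : 0 < bracket k ^ P := pow_pos (bracket_pos k) P
  have hOp := (hasSum_Op (hσ 0).smooth hf k).mul_right ((bracket k ^ P : ℝ) : ℂ)
  have hle := hOp.norm_le_of_bounded hs fun m => ?_
  · rwa [norm_mul, Complex.norm_real, Real.norm_of_nonneg hP.le] at hle
  rw [norm_mul, norm_mul, Complex.norm_real, Real.norm_of_nonneg hP.le]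
  have hb := bracket_pos (m - k)
  have hm := bracket_pos m
  have hkm : bracket k ≤ bracket m * bracket (m - k) := by
    have := bracket_add_le m (-(m - k))
    rwa [bracket_neg, neg_sub, add_sub_cancel] at this
  have h1 : ‖mFourierCoeff (σ k) (m - k)‖ * bracket k ^ P ≤ C * bracket m ^ M := by
    refine le_of_mul_le_mul_right ?_ (pow_pos hb M)
    calc ‖mFourierCoeff (σ k) (m - k)‖ * bracket k ^ P * bracket (m - k) ^ M
        = ‖mFourierCoeff (σ k) (m - k)‖ * bracket (m - k) ^ M * bracket k ^ P := by ring
      _ ≤ C * bracket k ^ (μ + δ * M) * bracket k ^ P :=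
        mul_le_mul_of_nonneg_right (h k (m - k)) hP.le
      _ = C * bracket k ^ (μ + δ * M + P) := by
        rw [bracket_rpow_add k _ (P : ℝ), Real.rpow_natCast]; ring
      _ ≤ C * bracket k ^ (M : ℝ) :=
        mul_le_mul_of_nonneg_left (bracket_rpow_mono k (by linarith)) hC
      _ ≤ C * (bracket m * bracket (m - k)) ^ M := by
        rw [Real.rpow_natCast]
        exact mul_le_mul_of_nonneg_left (pow_le_pow_left₀ (bracket_pos k).le hkm M) hC
      _ = C * bracket m ^ M * bracket (m - k) ^ M := by ring
  calc ‖f m‖ * ‖mFourierCoeff (σ k) (m - k)‖ * bracket k ^ P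
      = ‖f m‖ * (‖mFourierCoeff (σ k) (m - k)‖ * bracket k ^ P) := by ring
    _ ≤ ‖f m‖ * (C * bracket m ^ M) := mul_le_mul_of_nonneg_left h1 (norm_nonneg _)
    _ = _ := by ring

/-- Exchanging the sum over `η` with the integral defining `Op τ f` at `k + η`. -/
lemma Op_comp (hδ : 0 ≤ δ) (hδ1 : δ < 1) (hσ : ∀ L, SymbolUpTo ρ δ L μ σ)
    (hτ : ∀ L, SymbolUpTo ρ δ L ν τ) (hf : IsSchwartz f) :
    Op σ (Op τ f) = Op (compSymbol σ τ) f := by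
  funext k
  obtain ⟨C, hC, Q, hb⟩ := (hτ 0).hasOrder.exists_translate_bound
  have hfc := continuous_latticeFourier hf
  have h1 := (Equiv.addLeft k).hasSum_iff.2
    (hasSum_Op (hσ 0).smooth (isSchwartz_Op hδ hδ1 hτ hf) k)
  have hint : ∀ η, Integrable (fun x => mFourierCoeff (σ k) η *
      (mFourier (k + η) x * τ (k + η) x * latticeFourier f x)) (torusMeasure n) := fun η =>
    integrable_of_continuous (continuous_const.mul
      (((mFourier (k + η)).continuous.mul ((hτ 0).smooth (k + η)).continuous).mul hfc))
  have hsum : Summable fun η => ∫ x, ‖mFourierCoeff (σ k) η *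
      (mFourier (k + η) x * τ (k + η) x * latticeFourier f x)‖ ∂(torusMeasure n) := by
    refine Summable.of_nonneg_of_le (fun η => integral_nonneg fun x => norm_nonneg _)
      (fun η => ?_) ((summable_mFourierCoeff_mul hδ hσ k Q).mul_right
        (C * bracket k ^ ν * ∑' k, ‖f k‖))
    refine (Real.le_norm_self _).trans (norm_integral_le fun x => ?_)
    rw [norm_norm, norm_mul, norm_mul, norm_mul, norm_mFourier_apply, one_mul]
    have hp := bracket_rpow_pos k ν
    have hq := bracket_pos η
    calc ‖mFourierCoeff (σ k) η‖ * (‖τ (k + η) x‖ * ‖latticeFourier f x‖)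
        ≤ ‖mFourierCoeff (σ k) η‖ * ((C * bracket k ^ ν * bracket η ^ Q) * ∑' k, ‖f k‖) := by
          gcongr
          · exact hb k η x
          · exact norm_latticeFourier_le hf x
      _ = _ := by ring
  have h2 := hasSum_integral_of_summable_integral_norm hint hsum
  have e : ∫ x, ∑' η, mFourierCoeff (σ k) η *
      (mFourier (k + η) x * τ (k + η) x * latticeFourier f x) ∂(torusMeasure n) =
      Op (compSymbol σ τ) f k := by
    rw [Op]
    congr 1
    funext x
    rw [compSymbol, mul_comm (mFourier k x), mul_assoc, ← tsum_mul_right]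
    refine tsum_congr fun η => ?_
    rw [mFourier_add]
    ring
  rw [e] at h2
  refine h1.unique (h2.congr_fun fun η => ?_)
  rw [integral_const_mul, Function.comp_apply, Equiv.coe_addLeft, add_sub_cancel_left, mul_comm]
  rfl

end Quantization

end Lattice

end

theorem theorem3p1 (n : ℕ) (ρ δ μ₁ μ₂ : ℝ) (hδ : 0 ≤ δ) (hδρ : δ < ρ) (hρ : ρ ≤ 1)
    (σ τ : (Fin n → ℤ) → UnitAddTorus (Fin n) → ℂ)
    (hσ : Lattice.IsSymbol μ₁ ρ δ σ) (hτ : Lattice.IsSymbol μ₂ ρ δ τ) :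
    ∃ ς : (Fin n → ℤ) → UnitAddTorus (Fin n) → ℂ,
      Lattice.IsSymbol (μ₁ + μ₂) ρ δ ς ∧
      (∀ f : (Fin n → ℤ) → ℂ, Lattice.IsSchwartz f →
        Lattice.IsSchwartz (Lattice.Op τ f) ∧
        Lattice.IsSchwartz (Lattice.Op σ (Lattice.Op τ f)) ∧
        Lattice.Op σ (Lattice.Op τ f) = Lattice.Op ς f) ∧
      ∀ N : ℕ, Lattice.IsSymbol (μ₁ + μ₂ - (N : ℝ) * (ρ - δ)) ρ δ
        (fun k x => ς k x - ∑ α ∈ Lattice.multiIndicesLT n N, Lattice.compTerm σ τ α k x) := by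
  have hs := (Lattice.isSymbol_iff hδ).1 hσ
  have ht := (Lattice.isSymbol_iff hδ).1 hτ
  have hδ1 : δ < 1 := hδρ.trans_le hρ
  have hrem : ∀ N : ℕ, Lattice.IsSymbol (μ₁ + μ₂ - (N : ℝ) * (ρ - δ)) ρ δ
      (fun k x => Lattice.compSymbol σ τ k x -
        ∑ α ∈ Lattice.multiIndicesLT n N, Lattice.compTerm σ τ α k x) := fun N => by
    have h := (Lattice.isSymbol_iff hδ).2 (Lattice.symbolUpTo_compRem hδ hδρ hρ hs ht N)
    convert! h using 1
    funext k x
    simp only [Lattice.compRem, Pi.sub_apply, Finset.sum_apply]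
  refine ⟨Lattice.compSymbol σ τ, ?_, fun f hf => ?_, hrem⟩
  · -- the expansion of order `N = 0` is empty
    have h0 : Lattice.multiIndicesLT n 0 = ∅ := by
      ext α; simp [Lattice.mem_multiIndicesLT]
    simpa [h0] using hrem 0
  · have h1 := Lattice.isSchwartz_Op hδ hδ1 ht hf
    exact ⟨h1, Lattice.isSchwartz_Op hδ hδ1 hs h1, Lattice.Op_comp hδ hδ1 hs ht hf⟩
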